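/- For $\mu\in\mathbb{R}$ and $\nu\in\mathbb{C}$ let $W_{\mu,\nu}(x)$, $x>0$, be the Whittaker function, i.e. the solution of \[ \frac{d^{2}u}{dx^{2}}+\left(-\frac14+\frac{\mu}{x}+\frac{\frac14-\nu^{2}}{x^{2}}\right)u=0 \] on $(0,\infty)$ determined uniquely by $W_{\mu,\nu}(x)\sim x^{\mu}e^{-x/2}$ as $x\to\infty$. For $\mu\in\mathbb{R}$ and $z>0$ let $D_{\mu}(z)=2^{\frac{\mu}{2}+\frac14}z^{-\frac12}\,W_{\frac{\mu}{2}+\frac14,\frac14}\!\left(\frac{z^{2}}{2}\right)$ be the parabolic cylinder function. Then for all $\mu\in\mathbb{R}$ and $x>0$ we have the following pair of Fourier transforms, both integrals being absolutely convergent: for every $\xi\in\mathbb{R}$, \[ \int_{-\infty}^{\infty}W_{\mu,i\tau}(x)\,e^{-i\tau\xi}\,d\tau=2^{-\mu}\sqrt{\pi x}\;e^{\frac{x}{4}(1-\cosh \xi)}\,D_{2\mu}\!\left(\sqrt{2x}\,\cosh\tfrac{\xi}{2}\right), \] and for every $\tau\in\mathbb{R}$, \[ W_{\mu,i\tau}(x)=\sqrt{\frac{x}{\pi}}\;\frac{e^{x/4}}{2^{\mu+1}}\int_{-\infty}^{\infty}e^{-\frac{x}{4}\cosh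 \xi}\,D_{2\mu}\!\left(\sqrt{2x}\,\cosh\tfrac{\xi}{2}\right)e^{i\tau\xi}\,d\xi . \] -/

import Mathlib

open Asymptotics Filter MeasureTheory

/-- `u` is, on the half-line `x > 0`, a solution of Whittaker's differential equation
`u'' + (-1/4 + μ / x + (1/4 - ν²) / x²) u = 0` (with first derivative `u'`) which satisfies
`u x ∼ x ^ μ * exp (-x / 2)` as `x → ∞`.  For real `μ` and complex `ν` these conditions determine
the values of `u` on `x > 0`. -/
def IsWhittakerW (μ : ℝ) (ν : ℂ) (u : ℝ → ℂ) : Prop :=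
  (∃ u' : ℝ → ℂ, ∀ x : ℝ, 0 < x →
    HasDerivAt u (u' x) x ∧
    HasDerivAt u' (-((-(1 / 4 : ℂ) + (μ : ℂ) / (x : ℂ) + (1 / 4 - ν ^ 2) / (x : ℂ) ^ 2) * u x)) x) ∧
  u ~[atTop] fun x : ℝ => ((x ^ μ * Real.exp (-x / 2) : ℝ) : ℂ)

/-- The Whittaker function `W_{μ,ν}(x)` for `x > 0`, with `μ` real and `ν` complex: the solution of
Whittaker's equation on `x > 0` determined by `W_{μ,ν}(x) ∼ x ^ μ * exp (-x / 2)` as `x → ∞`.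
(The values at `x ≤ 0` carry no meaning.) -/
noncomputable def whittakerW (μ : ℝ) (ν : ℂ) : ℝ → ℂ :=
  Classical.epsilon (IsWhittakerW μ ν)

/-- The parabolic cylinder function `D_μ(z)`, for real `μ` and real `z > 0`:
`D_μ(z) = 2 ^ (μ/2 + 1/4) * z ^ (-1/2) * W_{μ/2 + 1/4, 1/4}(z² / 2)`. -/
noncomputable def parabolicCylinderD (μ z : ℝ) : ℂ :=
  ((2 ^ (μ / 2 + 1 / 4) * z ^ (-(1 / 2) : ℝ) : ℝ) : ℂ) *
    whittakerW (μ / 2 + 1 / 4) (1 / 4) (z ^ 2 / 2)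

/-! Let `H` be the Tricomi function U(-μ, 1/2, ·). Up to elementary factors it is the parabolic
cylinder function: D_{2μ}(z) = 2^μ e^{-z²/4} H(z²/2). By the half-angle formula, z = √(2x) cosh(ξ/2)
gives z²/2 = x(1 + cosh ξ)/2, so the second formula says that W_{μ,iτ}(x) is ½ √(x/π) times the
Fourier integral of the kernel e^{-(x/2) cosh ξ} H(x(1 + cosh ξ)/2).

This is proved by checking the two properties that characterise W. Differentiating under the
integral sign, integrating by parts twice in ξ and using Tricomi's equation for `H` gives
Whittaker's equation (`IsTricomi.whittaker_ode`). Laplace's method with ξ = η/√x gives the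
asymptotics (`IsTricomi.tendsto_coshMoment`). A Wronskian argument shows that nothing else has these
properties (`IsWhittakerW.eq`); since W is defined by choice, every evaluation of it rests on this.

The two integrations by parts also give decay like τ⁻² of the Fourier integral. It is therefore
integrable, and the first formula follows by Fourier inversion (`integral_fourier_mul_cexp`). -/

open Set Topology

/-! ### Construction of the Tricomi function U(-μ, 1/2, ·). -/

/-- The Laplace integral `∫₀^∞ e^{-yt} t^α (1+t)^β dt`. -/
noncomputable def tricomiIntegral (α β y : ℝ) : ℝ :=
  ∫ t in Ioi (0 : ℝ), Real.exp (-(y * t)) * (t ^ α * (1 + t) ^ β)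

theorem one_add_rpow_le_one {β t : ℝ} (hβ : β ≤ 0) (ht : 0 < t) : (1 + t) ^ β ≤ 1 :=
  Real.rpow_le_one_of_one_le_of_nonpos (by linarith) hβ

theorem norm_tricomi_integrand_le {α β y t : ℝ} (hβ : β ≤ 0) (ht : 0 < t) :
    ‖Real.exp (-(y * t)) * (t ^ α * (1 + t) ^ β)‖ ≤ t ^ α * Real.exp (-(y * t)) := by
  have h1 : 0 ≤ t ^ α := Real.rpow_nonneg ht.le _
  have h2 : 0 ≤ (1 + t) ^ β := Real.rpow_nonneg (by linarith) _
  have h3 := one_add_rpow_le_one hβ ht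
  rw [Real.norm_of_nonneg (by positivity), mul_comm]
  gcongr
  nlinarith

theorem aestronglyMeasurable_tricomi_integrand (α β y : ℝ) :
    AEStronglyMeasurable (fun t : ℝ => Real.exp (-(y * t)) * (t ^ α * (1 + t) ^ β))
      (volume.restrict (Ioi 0)) := by
  apply Measurable.aestronglyMeasurable
  fun_prop

theorem integrableOn_rpow_mul_exp_neg_mul {α y : ℝ} (hα : -1 < α) (hy : 0 < y) :
    IntegrableOn (fun t : ℝ => t ^ α * Real.exp (-(y * t))) (Ioi 0) := by
  simpa using integrableOn_rpow_mul_exp_neg_mul_rpow (p := 1) hα one_pos hy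

theorem integrableOn_tricomi_integrand {α β y : ℝ} (hα : -1 < α) (hβ : β ≤ 0) (hy : 0 < y) :
    IntegrableOn (fun t : ℝ => Real.exp (-(y * t)) * (t ^ α * (1 + t) ^ β)) (Ioi 0) := by
  refine Integrable.mono' (integrableOn_rpow_mul_exp_neg_mul hα hy)
    (aestronglyMeasurable_tricomi_integrand α β y) ?_
  filter_upwards [self_mem_ae_restrict measurableSet_Ioi] with t ht
  exact norm_tricomi_integrand_le hβ ht

theorem hasDerivAt_tricomiIntegral {α β y : ℝ} (hα : -1 < α) (hβ : β ≤ 0) (hy : 0 < y) :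
    HasDerivAt (tricomiIntegral α β) (-tricomiIntegral (α + 1) β y) y := by
  have h := hasDerivAt_integral_of_dominated_loc_of_deriv_le
    (μ := volume.restrict (Ioi (0 : ℝ))) (𝕜 := ℝ) (x₀ := y) (s := Ioi (y / 2))
    (F := fun y t => Real.exp (-(y * t)) * (t ^ α * (1 + t) ^ β))
    (F' := fun y t => -(Real.exp (-(y * t)) * (t ^ (α + 1) * (1 + t) ^ β)))
    (bound := fun t => t ^ (α + 1) * Real.exp (-(y / 2 * t)))
    (Ioi_mem_nhds (by linarith))
    (Eventually.of_forall fun z => aestronglyMeasurable_tricomi_integrand α β z)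
    (integrableOn_tricomi_integrand hα hβ hy)
    (aestronglyMeasurable_tricomi_integrand (α + 1) β y).neg ?_
    (integrableOn_rpow_mul_exp_neg_mul (by linarith) (by linarith)) ?_
  · have h2 := h.2
    rw [integral_neg] at h2
    exact h2
  · filter_upwards [self_mem_ae_restrict measurableSet_Ioi] with t ht z hz
    rw [norm_neg]
    refine (norm_tricomi_integrand_le hβ ht).trans ?_
    have ht' : 0 < t := ht
    have hz' : y / 2 < z := hz
    gcongr
  · filter_upwards [self_mem_ae_restrict measurableSet_Ioi] with t ht z hz
    have ht' : 0 < t := ht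
    have h1 : HasDerivAt (fun z : ℝ => -(z * t)) (-t) z := by
      simpa using ((hasDerivAt_id z).mul_const t).fun_neg
    refine (h1.exp.mul_const (t ^ α * (1 + t) ^ β)).congr_deriv ?_
    rw [Real.rpow_add_one ht'.ne']
    ring

/-- Leading order of Watson's lemma: substituting t/y for t leaves the factor (1 + t/y)^β, which
tends to 1 and is at most 1 because β ≤ 0, so dominated convergence applies. -/
theorem tendsto_rpow_mul_tricomiIntegral {α β : ℝ} (hα : -1 < α) (hβ : β ≤ 0) :
    Tendsto (fun y => y ^ (α + 1) * tricomiIntegral α β y) atTop (𝓝 (Real.Gamma (α + 1))) := by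
  have hΓ : Real.Gamma (α + 1) = ∫ t in Ioi (0 : ℝ), t ^ α * Real.exp (-t) := by
    rw [Real.Gamma_eq_integral (by linarith)]
    simp [mul_comm]
  have key : Tendsto (fun y : ℝ => ∫ t in Ioi (0 : ℝ), t ^ α * Real.exp (-t) * (1 + y⁻¹ * t) ^ β)
      atTop (𝓝 (∫ t in Ioi (0 : ℝ), t ^ α * Real.exp (-t))) := by
    refine tendsto_integral_filter_of_dominated_convergence
      (fun t => t ^ α * Real.exp (-t)) ?_ ?_ ?_ ?_
    · refine Eventually.of_forall fun y => Measurable.aestronglyMeasurable ?_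
      fun_prop
    · filter_upwards [eventually_gt_atTop 0] with y hy
      filter_upwards [self_mem_ae_restrict measurableSet_Ioi] with t ht
      have ht' : 0 < t := ht
      have h1 : 0 ≤ t ^ α * Real.exp (-t) := by positivity
      have h2 : (1 + y⁻¹ * t) ^ β ≤ 1 := one_add_rpow_le_one hβ (by positivity)
      rw [Real.norm_of_nonneg (by positivity)]
      nlinarith
    · simpa [IntegrableOn] using integrableOn_rpow_mul_exp_neg_mul hα one_pos
    · filter_upwards [self_mem_ae_restrict measurableSet_Ioi] with t ht
      have h1 : Tendsto (fun y : ℝ => 1 + y⁻¹ * t) atTop (𝓝 1) := by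
        simpa using (tendsto_inv_atTop_zero.mul_const t).const_add 1
      simpa using (h1.rpow_const (p := β) (Or.inl one_ne_zero)).const_mul (t ^ α * Real.exp (-t))
  rw [hΓ]
  refine key.congr' ?_
  filter_upwards [eventually_gt_atTop 0] with y hy
  have h := integral_comp_mul_left_Ioi
    (fun t : ℝ => t ^ α * Real.exp (-t) * (1 + y⁻¹ * t) ^ β) 0 hy
  rw [mul_zero] at h
  have h2 : ∫ t in Ioi (0 : ℝ), t ^ α * Real.exp (-t) * (1 + y⁻¹ * t) ^ β =
      y * ∫ t in Ioi (0 : ℝ), (y * t) ^ α * Real.exp (-(y * t)) * (1 + y⁻¹ * (y * t)) ^ β := by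
    rw [h, smul_eq_mul]
    field_simp
  rw [h2, tricomiIntegral, Real.rpow_add_one hy.ne', mul_comm (y ^ α), mul_assoc,
    ← integral_const_mul (y ^ α)]
  congr 1
  refine setIntegral_congr_fun measurableSet_Ioi fun t ht => ?_
  have ht' : 0 < t := ht
  rw [Real.mul_rpow hy.le ht'.le, inv_mul_cancel_left₀ hy.ne']
  ring

theorem tendsto_exp_mul_rpow_mul_one_add_rpow {α β y : ℝ} (hβ : β ≤ 0) (hy : 0 < y) :
    Tendsto (fun t : ℝ => Real.exp (-(y * t)) * (t ^ α * (1 + t) ^ β)) atTop (𝓝 0) := by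
  refine squeeze_zero_norm' ?_ (tendsto_rpow_mul_exp_neg_mul_atTop_nhds_zero α y hy)
  filter_upwards [eventually_gt_atTop 0] with t ht
  simpa using norm_tricomi_integrand_le (y := y) hβ ht

/-- The integrand of the left side is minus the t-derivative of e^{-yt} t^a (1+t)^{1/2-a}, which
vanishes at both ends as a > 0. Since differentiation in y raises the exponent of t by one and
changes the sign, this is Tricomi's equation for the integral with exponent a - 1. -/
theorem tricomiIntegral_relation {a y : ℝ} (ha : 0 < a) (hy : 0 < y) :
    y * tricomiIntegral (a + 1) (-a - 1 / 2) y + (y - 1 / 2) * tricomiIntegral a (-a - 1 / 2) y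
      - a * tricomiIntegral (a - 1) (-a - 1 / 2) y = 0 := by
  set β : ℝ := -a - 1 / 2 with hβdef
  have hβ : β ≤ 0 := by rw [hβdef]; linarith
  have i1 := integrableOn_tricomi_integrand (α := a + 1) (y := y) (by linarith) hβ hy
  have i2 := integrableOn_tricomi_integrand (α := a) (y := y) (by linarith) hβ hy
  have i3 := integrableOn_tricomi_integrand (α := a - 1) (y := y) (by linarith) hβ hy
  have h := integral_Ioi_of_hasDerivAt_of_tendsto (a := 0) (m := 0)
    (f := fun t : ℝ => Real.exp (-(y * t)) * (t ^ a * (1 + t) ^ (β + 1)))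
    (f' := fun t : ℝ => -(y * (Real.exp (-(y * t)) * (t ^ (a + 1) * (1 + t) ^ β))
      + (y - 1 / 2) * (Real.exp (-(y * t)) * (t ^ a * (1 + t) ^ β))
      - a * (Real.exp (-(y * t)) * (t ^ (a - 1) * (1 + t) ^ β)))) ?_ ?_ ?_ ?_
  · rw [integral_neg, integral_sub, integral_add, integral_const_mul, integral_const_mul,
      integral_const_mul] at h
    · have h0 : (0 : ℝ) ^ a = 0 := Real.zero_rpow ha.ne'
      simp only [h0] at h
      simp only [tricomiIntegral]
      linarith
    · exact i1.const_mul y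
    · exact i2.const_mul _
    · exact (i1.const_mul y).add (i2.const_mul _)
    · exact i3.const_mul _
  · apply ContinuousAt.continuousWithinAt
    have h1 : ContinuousAt (fun t : ℝ => t ^ a) 0 := Real.continuousAt_rpow_const _ _ (Or.inr ha.le)
    have h2 : ContinuousAt (fun t : ℝ => (1 + t) ^ (β + 1)) 0 :=
      ContinuousAt.rpow_const (by fun_prop) (Or.inl (by norm_num))
    exact (by fun_prop : ContinuousAt (fun t : ℝ => Real.exp (-(y * t))) 0).mul (h1.mul h2)
  · intro t ht
    have ht' : 0 < t := ht
    have h1 : HasDerivAt (fun t : ℝ => -(y * t)) (-y) t := by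
      simpa using ((hasDerivAt_id t).const_mul y).fun_neg
    have h2 : HasDerivAt (fun t : ℝ => t ^ a) (a * t ^ (a - 1)) t :=
      Real.hasDerivAt_rpow_const (Or.inl ht'.ne')
    have h3 : HasDerivAt (fun t : ℝ => (1 + t) ^ (β + 1)) ((β + 1) * (1 + t) ^ β) t := by
      have := ((hasDerivAt_id t).const_add 1).rpow_const (p := β + 1) (Or.inl (by simp; linarith))
      simpa using this
    refine (h1.exp.mul (h2.mul h3)).congr_deriv ?_
    have e1 : t ^ a = t ^ (a - 1) * t := by
      rw [← Real.rpow_add_one ht'.ne']; ring_nf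
    have e2 : t ^ (a + 1) = t ^ (a - 1) * t * t := by
      rw [Real.rpow_add_one ht'.ne', e1]
    have e3 : (1 + t) ^ (β + 1) = (1 + t) ^ β * (1 + t) := Real.rpow_add_one (by linarith) _
    have e4 : a = -β - 1 / 2 := by rw [hβdef]; ring
    simp only [Pi.mul_apply, e1, e2, e3]
    linear_combination (-Real.exp (-(y * t)) * t ^ (a - 1) * (1 + t) ^ β * t) * e4
  · exact (((i1.const_mul y).add (i2.const_mul _)).sub (i3.const_mul _)).neg
  · have := (tendsto_exp_mul_rpow_mul_one_add_rpow (α := a) hβ hy).add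
      (tendsto_exp_mul_rpow_mul_one_add_rpow (α := a + 1) hβ hy)
    rw [add_zero] at this
    refine this.congr' ?_
    filter_upwards [eventually_gt_atTop 0] with t ht
    rw [Real.rpow_add_one ht.ne', Real.rpow_add_one (by linarith)]
    ring

/-- `H`, with derivative `H'`, is on `y > 0` the Tricomi function `U(-μ, 1/2, ·)`: a solution of
`y H'' = (y - 1/2) H' - μ H` with `H ∼ y ^ μ` and `H' = o(y ^ μ)` as `y → ∞`. -/
structure IsTricomi (μ : ℝ) (H H' : ℝ → ℝ) : Prop where
  hasDerivAt : ∀ y, 0 < y → HasDerivAt H (H' y) y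
  hasDerivAt' : ∀ y, 0 < y → HasDerivAt H' (((y - 1 / 2) * H' y - μ * H y) / y) y
  tendsto : Tendsto (fun y => H y / y ^ μ) atTop (𝓝 1)
  tendsto' : Tendsto (fun y => H' y / y ^ μ) atTop (𝓝 0)

/-- For a = -μ > 0 the classical formula Γ(a) U(a, 1/2, y) = ∫ e^{-yt} t^{a-1} (1+t)^{-a-1/2} dt is
available. -/
theorem exists_isTricomi_of_neg {μ : ℝ} (hμ : μ < 0) : ∃ H H', IsTricomi μ H H' := by
  obtain ⟨a, rfl⟩ : ∃ a, μ = -a := ⟨-μ, by ring⟩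
  have ha : 0 < a := by linarith
  set β : ℝ := -a - 1 / 2 with hβdef
  have hβ : β ≤ 0 := by rw [hβdef]; linarith
  have hΓ := (Real.Gamma_pos_of_pos ha).ne'
  refine ⟨fun y => tricomiIntegral (a - 1) β y / Real.Gamma a,
    fun y => -tricomiIntegral a β y / Real.Gamma a, ⟨?_, ?_, ?_, ?_⟩⟩
  · intro y hy
    have := (hasDerivAt_tricomiIntegral (α := a - 1) (by linarith) hβ hy).div_const (Real.Gamma a)
    simpa using this
  · intro y hy
    have := (hasDerivAt_tricomiIntegral (α := a) (by linarith) hβ hy).neg.div_const (Real.Gamma a)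
    refine this.congr_deriv ?_
    have h := tricomiIntegral_relation ha hy
    rw [← hβdef] at h
    field_simp
    linear_combination 2 * h
  · have := (tendsto_rpow_mul_tricomiIntegral (α := a - 1) (by linarith) hβ).div_const
      (Real.Gamma a)
    rw [sub_add_cancel, div_self hΓ] at this
    refine this.congr' ?_
    filter_upwards [eventually_gt_atTop 0] with y hy
    rw [Real.rpow_neg hy.le]
    field_simp
  · have := ((tendsto_rpow_mul_tricomiIntegral (α := a) (by linarith) hβ).div_const
      (Real.Gamma a)).mul tendsto_inv_atTop_zero
    rw [mul_zero] at this
    have := this.neg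
    rw [neg_zero] at this
    refine this.congr' ?_
    filter_upwards [eventually_gt_atTop 0] with y hy
    rw [Real.rpow_neg hy.le, Real.rpow_add_one hy.ne']
    field_simp

/-- A contiguous relation, which carries the construction from μ < 0 to all real μ. The limit of the
new function needs H' = o(y^μ), which is why that condition is part of `IsTricomi`. -/
theorem IsTricomi.raise {μ : ℝ} {H H' : ℝ → ℝ} (h : IsTricomi μ H H') :
    IsTricomi (μ + 1) (fun y => (y - μ - 1 / 2) * H y - y * H' y)
      (fun y => (1 + μ) * (H y - H' y)) := by
  have hinv := tendsto_inv_atTop_zero (𝕜 := ℝ)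
  refine ⟨?_, ?_, ?_, ?_⟩
  · intro y hy
    have h1 : HasDerivAt (fun y : ℝ => y - μ - 1 / 2) 1 y := by
      simpa using ((hasDerivAt_id y).sub_const μ).sub_const (1 / 2)
    refine ((h1.mul (h.hasDerivAt y hy)).sub
      ((hasDerivAt_id y).mul (h.hasDerivAt' y hy))).congr_deriv ?_
    simp only [id]
    field_simp
    ring
  · intro y hy
    refine (((h.hasDerivAt y hy).sub (h.hasDerivAt' y hy)).const_mul (1 + μ)).congr_deriv ?_
    field_simp
    ring
  · have h1 : Tendsto (fun y : ℝ => (1 - (μ + 1 / 2) * y⁻¹) * (H y / y ^ μ) - H' y / y ^ μ)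
        atTop (𝓝 1) := by
      have := (((hinv.const_mul (μ + 1 / 2)).const_sub 1).mul h.tendsto).sub h.tendsto'
      simpa using this
    refine h1.congr' ?_
    filter_upwards [eventually_gt_atTop 0] with y hy
    have := (Real.rpow_pos_of_pos hy μ).ne'
    rw [Real.rpow_add_one hy.ne']
    field_simp
    ring
  · have h1 := (((h.tendsto.sub h.tendsto').const_mul (1 + μ)).mul hinv)
    rw [mul_zero] at h1
    refine h1.congr' ?_
    filter_upwards [eventually_gt_atTop 0] with y hy
    have := (Real.rpow_pos_of_pos hy μ).ne'
    rw [Real.rpow_add_one hy.ne']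
    field_simp

theorem exists_isTricomi (μ : ℝ) : ∃ H H', IsTricomi μ H H' := by
  obtain ⟨n, hn⟩ := exists_nat_gt μ
  have key : ∀ n : ℕ, ∀ μ : ℝ, μ < n → ∃ H H', IsTricomi μ H H' := by
    intro n
    induction n with
    | zero => exact fun μ hμ => exists_isTricomi_of_neg (by simpa using hμ)
    | succ n ih =>
      intro μ hμ
      push_cast at hμ
      obtain ⟨H, H', h⟩ := ih (μ - 1) (by linarith)
      have := h.raise
      rw [sub_add_cancel] at this
      exact ⟨_, _, this⟩
  exact key n μ hn

/-! ### Uniqueness of the Whittaker function. -/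

/-- A solution on `x > 0` of `u'' = q u`, with continuous `q`, which vanishes together with its
first derivative at a point `b`, vanishes on `(0, b]`. -/
theorem eq_zero_of_hasDerivAt_of_le {q w w' : ℝ → ℂ} (hq : ContinuousOn q (Ioi 0))
    (hw : ∀ x, 0 < x → HasDerivAt w (w' x) x) (hw' : ∀ x, 0 < x → HasDerivAt w' (q x * w x) x)
    {a b : ℝ} (ha : 0 < a) (hab : a ≤ b) (h0 : w b = 0) (h1 : w' b = 0) : w a = 0 := by
  obtain ⟨C, hC⟩ := isCompact_Icc.exists_bound_of_continuousOn
    (hq.mono fun t (ht : t ∈ Icc a b) => lt_of_lt_of_le ha ht.1)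
  have hpos : ∀ t ∈ Icc a b, 0 < t := fun t ht => lt_of_lt_of_le ha ht.1
  have hf : ∀ t, 0 < t → HasDerivAt (fun t => (w t, w' t)) ((w' t, q t * w t) : ℂ × ℂ) t :=
    fun t ht => (hw t ht).prodMk (hw' t ht)
  have hz : ∀ t : ℝ, HasDerivAt (fun _ : ℝ => (0 : ℂ × ℂ)) ((0, q t * 0) : ℂ × ℂ) t := by
    intro t
    rw [mul_zero]
    exact hasDerivAt_const t (0 : ℂ × ℂ)
  -- The equation becomes a linear first-order system for the pair (w, w'), Lipschitz with constant
  -- max(1, C) where C bounds q on [a, b].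
  have key := ODE_solution_unique_of_mem_Icc_left (a := a) (b := b)
    (v := fun t (p : ℂ × ℂ) => (p.2, q t * p.1)) (s := fun _ => univ)
    (K := Real.toNNReal (max 1 C)) (f := fun t => (w t, w' t)) (g := fun _ => 0) ?_
    (fun t ht => (hf t (hpos t ht)).continuousAt.continuousWithinAt)
    (fun t ht => (hf t (hpos t (Ioc_subset_Icc_self ht))).hasDerivWithinAt)
    (fun _ _ => mem_univ _) continuousOn_const
    (fun t _ => (hz t).hasDerivWithinAt) (fun _ _ => mem_univ _) (by simp [h0, h1])
  · exact congrArg Prod.fst (key (left_mem_Icc.2 hab))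
  · intro t ht
    refine LipschitzOnWith.of_dist_le_mul fun p _ r _ => ?_
    rw [Real.coe_toNNReal _ (le_max_of_le_left zero_le_one)]
    have hqt := hC t (Ioc_subset_Icc_self ht)
    have e : dist (q t * p.1) (q t * r.1) = ‖q t‖ * dist p.1 r.1 := by
      rw [dist_eq_norm, dist_eq_norm, ← mul_sub, norm_mul]
    rw [Prod.dist_eq, Prod.dist_eq, e]
    have d1 := le_max_left (dist p.1 r.1) (dist p.2 r.2)
    have d2 := le_max_right (dist p.1 r.1) (dist p.2 r.2)
    have m1 := le_max_left 1 C
    have m2 := le_max_right 1 C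
    have p1 : 0 ≤ dist p.1 r.1 := dist_nonneg
    have p2 : 0 ≤ dist p.2 r.2 := dist_nonneg
    refine max_le ?_ ?_
    · calc dist p.2 r.2 ≤ 1 * max (dist p.1 r.1) (dist p.2 r.2) := by linarith
        _ ≤ _ := by gcongr
    · calc ‖q t‖ * dist p.1 r.1 ≤ max 1 C * max (dist p.1 r.1) (dist p.2 r.2) := by
            gcongr
            exact hqt.trans m2

theorem eq_of_hasDerivAt_zero_Ioi {f : ℝ → ℂ} {X : ℝ}
    (hf : ∀ x, X < x → HasDerivAt f 0 x) {x y : ℝ} (hx : X < x) (hy : X < y) : f x = f y :=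
  isOpen_Ioi.is_const_of_deriv_eq_zero isPreconnected_Ioi
    (fun x hx => (hf x hx).differentiableAt.differentiableWithinAt)
    (fun x hx => (hf x hx).deriv) hx hy

theorem not_tendsto_of_deriv_ge_one {g g' : ℝ → ℝ} {l : ℝ} (hg : ∀ᶠ x in atTop, HasDerivAt g (g' x) x)
    (hg' : ∀ᶠ x in atTop, 1 ≤ g' x) : ¬ Tendsto g atTop (𝓝 l) := by
  intro h
  have h1 : Tendsto (fun x => g (x + 1) - g x) atTop (𝓝 0) := by
    simpa using (h.comp (tendsto_atTop_add_const_right atTop (1 : ℝ) tendsto_id)).sub h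
  obtain ⟨X, hX⟩ := eventually_atTop.1 (hg.and hg')
  have h2 : ∀ᶠ x in atTop, 1 ≤ g (x + 1) - g x := by
    filter_upwards [eventually_ge_atTop X] with x hx
    obtain ⟨c, hc, hc'⟩ := exists_hasDerivAt_eq_slope g g' (by linarith : x < x + 1)
      (fun y hy => (hX y (hx.trans hy.1)).1.continuousAt.continuousWithinAt)
      (fun y hy => (hX y (hx.trans hy.1.le)).1)
    have := (hX c (hx.trans hc.1.le)).2
    rw [hc'] at this
    simpa using this
  have := ge_of_tendsto h1 h2
  linarith

/-- Let w = u - v. The Wronskian c of u and w is constant and (w/u)' = c/u². Both solutions have the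
same leading term, so w/u → 0; but u decays, so c/u² would blow up unless c = 0. Then w/u is
constant near infinity, hence zero there, and w vanishes on all of (0, ∞) by backward uniqueness. -/
theorem IsWhittakerW.eq {μ : ℝ} {ν : ℂ} {u v : ℝ → ℂ} (hu : IsWhittakerW μ ν u)
    (hv : IsWhittakerW μ ν v) {x : ℝ} (hx : 0 < x) : u x = v x := by
  obtain ⟨⟨u', hu'⟩, hua⟩ := hu
  obtain ⟨⟨v', hv'⟩, hva⟩ := hv
  set q : ℝ → ℂ := fun x => -(-(1 / 4 : ℂ) + (μ : ℂ) / (x : ℂ) + (1 / 4 - ν ^ 2) / (x : ℂ) ^ 2)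
    with hq
  set φ : ℝ → ℝ := fun x => x ^ μ * Real.exp (-x / 2) with hφ
  have hφpos : ∀ x, 0 < x → 0 < φ x := fun x hx =>
    mul_pos (Real.rpow_pos_of_pos hx _) (Real.exp_pos _)
  have hqc : ContinuousOn q (Ioi 0) := by
    have hne : ∀ x ∈ Ioi (0 : ℝ), (x : ℂ) ≠ 0 := fun x hx => Complex.ofReal_ne_zero.2 (ne_of_gt hx)
    have hc : ContinuousOn (fun x : ℝ => (x : ℂ)) (Ioi 0) := Complex.continuous_ofReal.continuousOn
    exact (((continuousOn_const.add (continuousOn_const.div hc hne))).add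
      (continuousOn_const.div (hc.pow 2) fun x hx => pow_ne_zero 2 (hne x hx))).neg
  have hφne : ∀ᶠ x in atTop, ((φ x : ℝ) : ℂ) ≠ 0 := by
    filter_upwards [eventually_gt_atTop 0] with x hx
    exact Complex.ofReal_ne_zero.2 (hφpos x hx).ne'
  have hur : Tendsto (fun x => u x / (φ x : ℂ)) atTop (𝓝 1) :=
    (isEquivalent_iff_tendsto_one hφne).1 hua
  have hvr : Tendsto (fun x => v x / (φ x : ℂ)) atTop (𝓝 1) :=
    (isEquivalent_iff_tendsto_one hφne).1 hva
  set w : ℝ → ℂ := fun x => u x - v x with hw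
  set w' : ℝ → ℂ := fun x => u' x - v' x with hw'
  have hwd : ∀ x, 0 < x → HasDerivAt w (w' x) x := fun x hx => (hu' x hx).1.sub (hv' x hx).1
  have hwd' : ∀ x, 0 < x → HasDerivAt w' (q x * w x) x := fun x hx =>
    ((hu' x hx).2.sub (hv' x hx).2).congr_deriv (by simp only [hq, hw]; ring)
  have hune : ∀ᶠ x in atTop, u x ≠ 0 := by
    filter_upwards [hur.eventually_ne one_ne_zero] with x hx h0
    simp [h0] at hx
  have hr : Tendsto (fun x => w x / u x) atTop (𝓝 0) := by
    have := (hur.sub hvr).div hur one_ne_zero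
    rw [sub_self, zero_div] at this
    refine this.congr' ?_
    filter_upwards [hφne, hune] with x h1 h2
    simp only [hw, Pi.div_apply]
    field_simp
  have hWr : ∀ x, 0 < x → HasDerivAt (fun x => u x * w' x - u' x * w x) 0 x := by
    intro x hx
    refine (((hu' x hx).1.mul (hwd' x hx)).sub ((hu' x hx).2.mul (hwd x hx))).congr_deriv ?_
    simp only [hq]
    ring
  set c : ℂ := u 1 * w' 1 - u' 1 * w 1 with hc
  have hWc : ∀ x, 0 < x → u x * w' x - u' x * w x = c := fun x hx =>
    eq_of_hasDerivAt_zero_Ioi hWr hx one_pos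
  have hrd : ∀ᶠ x in atTop, HasDerivAt (fun x => w x / u x) (c / u x ^ 2) x := by
    filter_upwards [hune, eventually_gt_atTop 0] with x h1 h2
    refine ((hwd x h2).div (hu' x h2).1 h1).congr_deriv ?_
    rw [← hWc x h2]
    ring
  have hc0 : c = 0 := by
    by_contra hne
    have hcpos : 0 < ‖c‖ ^ 2 := by positivity
    -- Multiplying by the conjugate of c reduces to a real function: its derivative is the real part
    -- of (|c|²/φ²)(u/φ)⁻², which is eventually at least 2 · ½ = 1.
    have h1 : Tendsto (fun x => (starRingEnd ℂ c * (w x / u x)).re) atTop (𝓝 0) := by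
      have := hr.const_mul (starRingEnd ℂ c)
      rw [mul_zero] at this
      exact (Complex.continuous_re.tendsto 0).comp this
    refine not_tendsto_of_deriv_ge_one (g' := fun x => (starRingEnd ℂ c * (c / u x ^ 2)).re)
      ?_ ?_ h1
    · filter_upwards [hrd] with x hx
      exact Complex.reCLM.hasFDerivAt.comp_hasDerivAt x (hx.const_mul _)
    · have h2 : Tendsto (fun x => (((u x / (φ x : ℂ)) ^ 2)⁻¹).re) atTop (𝓝 1) := by
        have := (hur.pow 2).inv₀ (by norm_num)
        rw [one_pow, inv_one] at this
        rw [← Complex.one_re]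
        exact (Complex.continuous_re.tendsto 1).comp this
      have h3 : Tendsto φ atTop (𝓝 0) := by
        have := tendsto_rpow_mul_exp_neg_mul_atTop_nhds_zero μ (1 / 2) (by norm_num)
        refine this.congr fun x => ?_
        simp only [hφ]
        ring_nf
      have h4 : ∀ᶠ x in atTop, φ x ^ 2 < ‖c‖ ^ 2 / 2 := by
        have := h3.pow 2
        rw [zero_pow two_ne_zero] at this
        exact this.eventually_lt_const (by positivity)
      filter_upwards [h2.eventually_const_lt (by norm_num : (1 / 2 : ℝ) < 1), h4,
        eventually_gt_atTop 0, hune] with x k1 k2 k3 k4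
      have hp := hφpos x k3
      have e : starRingEnd ℂ c * (c / u x ^ 2) =
          ((‖c‖ ^ 2 / φ x ^ 2 : ℝ) : ℂ) * ((u x / (φ x : ℂ)) ^ 2)⁻¹ := by
        have : (φ x : ℂ) ≠ 0 := Complex.ofReal_ne_zero.2 hp.ne'
        rw [mul_div_assoc', Complex.conj_mul']
        push_cast
        field_simp
      rw [e, Complex.re_ofReal_mul]
      have k5 : 2 ≤ ‖c‖ ^ 2 / φ x ^ 2 := by
        rw [le_div_iff₀ (by positivity)]
        linarith
      nlinarith
  have hw0 : ∀ᶠ x in atTop, w x = 0 := by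
    obtain ⟨X, hX⟩ := eventually_atTop.1 (hrd.and hune)
    filter_upwards [eventually_gt_atTop X] with x hx
    have hconst : ∀ y, X < y → w y / u y = w x / u x := fun y hy =>
      eq_of_hasDerivAt_zero_Ioi (fun z hz => (hX z (le_of_lt hz)).1.congr_deriv (by simp [hc0]))
        hy hx
    have : w x / u x = 0 := by
      refine tendsto_nhds_unique (tendsto_const_nhds.congr' ?_) hr
      filter_upwards [eventually_gt_atTop X] with y hy
      exact (hconst y hy).symm
    exact (div_eq_zero_iff.1 this).resolve_right (hX x hx.le).2
  obtain ⟨X, hX⟩ := eventually_atTop.1 hw0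
  set b := max x (X + 1) with hb
  have hbX : X < b := lt_of_lt_of_le (by linarith) (le_max_right _ _)
  have hxb : x ≤ b := le_max_left _ _
  have hw'b : w' b = 0 := by
    refine (hwd b (hx.trans_le hxb)).unique ((hasDerivAt_const b (0 : ℂ)).congr_of_eventuallyEq ?_)
    filter_upwards [Ioi_mem_nhds hbX] with y hy
    exact hX y (le_of_lt hy)
  exact sub_eq_zero.1 (eq_zero_of_hasDerivAt_of_le hqc hwd hwd' hx hxb (hX b hbX.le) hw'b)

theorem IsWhittakerW.whittakerW_eq {μ : ℝ} {ν : ℂ} {u : ℝ → ℂ} (hu : IsWhittakerW μ ν u)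
    {x : ℝ} (hx : 0 < x) : whittakerW μ ν x = u x :=
  (Classical.epsilon_spec (p := IsWhittakerW μ ν) ⟨u, hu⟩).eq hu hx

/-! ### The parabolic cylinder function in terms of the Tricomi function. -/

/-- The factor y^{1/4} e^{-y/2} removes the first-order term from Tricomi's equation. The power is
y^{1/2+ν} with ν = -1/4; the equation sees only ν². -/
theorem IsTricomi.isWhittakerW {μ : ℝ} {H H' : ℝ → ℝ} (h : IsTricomi μ H H') :
    IsWhittakerW (μ + 1 / 4) (1 / 4)
      (fun y => ((y ^ (1 / 4 : ℝ) * Real.exp (-y / 2) * H y : ℝ) : ℂ)) := by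
  refine ⟨⟨fun y => ((y ^ (1 / 4 : ℝ) * Real.exp (-y / 2) *
    ((1 / (4 * y) - 1 / 2) * H y + H' y) : ℝ) : ℂ), fun y hy => ⟨?_, ?_⟩⟩, ?_⟩
  · have h1 : HasDerivAt (fun y : ℝ => y ^ (1 / 4 : ℝ)) (y ^ (1 / 4 : ℝ) / (4 * y)) y := by
      refine (Real.hasDerivAt_rpow_const (Or.inl hy.ne')).congr_deriv ?_
      rw [Real.rpow_sub_one hy.ne']
      field_simp
    have h2 : HasDerivAt (fun y : ℝ => -y / 2) (-1 / 2) y :=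
      ((hasDerivAt_id y).fun_neg).div_const 2
    refine ((h1.mul h2.exp).mul (h.hasDerivAt y hy)).ofReal_comp.congr_deriv ?_
    rw [Pi.mul_apply, Complex.ofReal_inj]
    field_simp
    ring
  · have h1 : HasDerivAt (fun y : ℝ => y ^ (1 / 4 : ℝ)) (y ^ (1 / 4 : ℝ) / (4 * y)) y := by
      refine (Real.hasDerivAt_rpow_const (Or.inl hy.ne')).congr_deriv ?_
      rw [Real.rpow_sub_one hy.ne']
      field_simp
    have h2 : HasDerivAt (fun y : ℝ => -y / 2) (-1 / 2) y :=
      ((hasDerivAt_id y).fun_neg).div_const 2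
    have h3 : HasDerivAt (fun y : ℝ => 1 / (4 * y) - 1 / 2) (-1 / (4 * y ^ 2)) y := by
      have := ((hasDerivAt_const y (1 : ℝ)).div ((hasDerivAt_id y).const_mul 4)
        (by simp [hy.ne'])).sub_const (1 / 2)
      refine this.congr_deriv ?_
      simp only [id]
      field_simp
      ring
    have h4 := (h1.mul h2.exp).mul ((h3.mul (h.hasDerivAt y hy)).add (h.hasDerivAt' y hy))
    refine h4.ofReal_comp.congr_deriv ?_
    have e : (-((-(1 / 4 : ℂ) + ((μ + 1 / 4 : ℝ) : ℂ) / (y : ℂ) + (1 / 4 - (1 / 4) ^ 2) / (y : ℂ) ^ 2)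
        * ((y ^ (1 / 4 : ℝ) * Real.exp (-y / 2) * H y : ℝ) : ℂ))) =
        ((-((-(1 / 4) + (μ + 1 / 4) / y + (1 / 4 - (1 / 4) ^ 2) / y ^ 2) *
          (y ^ (1 / 4 : ℝ) * Real.exp (-y / 2) * H y)) : ℝ) : ℂ) := by
      push_cast
      ring
    rw [e, Complex.ofReal_inj]
    simp only [Pi.mul_apply, Pi.add_apply]
    field_simp
    ring
  · refine (isEquivalent_iff_tendsto_one ?_).2 ?_
    · filter_upwards [eventually_gt_atTop 0] with x hx
      exact Complex.ofReal_ne_zero.2 (by positivity)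
    · have := (Complex.continuous_ofReal.tendsto 1).comp h.tendsto
      rw [Complex.ofReal_one] at this
      refine this.congr' ?_
      filter_upwards [eventually_gt_atTop 0] with x hx
      simp only [Function.comp, Pi.div_apply]
      rw [← Complex.ofReal_div, Complex.ofReal_inj, Real.rpow_add hx]
      have : x ^ μ ≠ 0 := by positivity
      have : x ^ (1 / 4 : ℝ) ≠ 0 := by positivity
      field_simp

theorem IsTricomi.parabolicCylinderD_eq {μ : ℝ} {H H' : ℝ → ℝ} (h : IsTricomi μ H H') {z : ℝ}
    (hz : 0 < z) : parabolicCylinderD (2 * μ) z =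
      ((2 ^ μ * Real.exp (-z ^ 2 / 4) * H (z ^ 2 / 2) : ℝ) : ℂ) := by
  have hμ : 2 * μ / 2 + 1 / 4 = μ + 1 / 4 := by ring
  rw [parabolicCylinderD, hμ, h.isWhittakerW.whittakerW_eq (by positivity), ← Complex.ofReal_mul,
    Complex.ofReal_inj]
  have e1 : (z ^ 2 / 2) ^ (1 / 4 : ℝ) = z ^ (1 / 2 : ℝ) / 2 ^ (1 / 4 : ℝ) := by
    rw [Real.div_rpow (by positivity) (by norm_num), ← Real.rpow_natCast, ← Real.rpow_mul hz.le]
    norm_num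
  have e2 : -(z ^ 2 / 2) / 2 = -z ^ 2 / 4 := by ring
  rw [e1, e2, Real.rpow_add two_pos, Real.rpow_neg hz.le]
  have : z ^ (1 / 2 : ℝ) ≠ 0 := by positivity
  field_simp

/-! ### Kernel integrals: Gaussian bounds, differentiation, integration by parts. -/

theorem one_add_sq_div_two_le_cosh (t : ℝ) : 1 + t ^ 2 / 2 ≤ Real.cosh t := by
  have h1 : Real.cosh t = 1 + 2 * Real.sinh (t / 2) ^ 2 := by
    have := Real.cosh_two_mul (t / 2)
    rw [mul_div_cancel₀ t two_ne_zero, Real.cosh_sq] at this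
    linarith
  have h2 : (t / 2) ^ 2 ≤ Real.sinh (t / 2) ^ 2 := by
    rw [sq_le_sq]
    rcases le_total 0 (t / 2) with h | h
    · rw [abs_of_nonneg h, abs_of_nonneg (Real.sinh_nonneg_iff.2 h)]
      exact Real.self_le_sinh_iff.2 h
    · rw [abs_of_nonpos h, abs_of_nonpos (Real.sinh_nonpos_iff.2 h)]
      exact neg_le_neg (Real.sinh_le_self_iff.2 h)
  rw [h1]
  nlinarith

/-- One term of the exponential series. It lets part of the decay e^{-(x/2) cosh ξ} absorb all
polynomial factors in cosh ξ. -/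
theorem cosh_pow_le (m : ℕ) {ε : ℝ} (hε : 0 < ε) (ξ : ℝ) :
    Real.cosh ξ ^ m ≤ m.factorial / ε ^ m * Real.exp (ε * Real.cosh ξ) := by
  have h := Real.pow_div_factorial_le_exp (ε * Real.cosh ξ)
    (mul_nonneg hε.le (Real.cosh_pos ξ).le) m
  have hf : (0 : ℝ) < m.factorial := by positivity
  rw [div_le_iff₀ hf, mul_pow] at h
  rw [div_mul_eq_mul_div, le_div_iff₀ (by positivity)]
  linarith

/-- A continuous function on `s > 0` with at most polynomial growth on each `[ε, ∞)`. -/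
structure IsAmplitude (G : ℝ → ℝ) : Prop where
  continuousOn : ContinuousOn G (Ioi 0)
  growth : ∀ ε, 0 < ε → ∃ (C : ℝ) (N : ℕ), ∀ s, ε ≤ s → |G s| ≤ C * (1 + s) ^ N

/-- A continuous function bounded by a multiple of a power of `cosh`. -/
structure IsCoshBounded (P : ℝ → ℝ) : Prop where
  continuous : Continuous P
  growth : ∃ (B : ℝ) (n : ℕ), ∀ ξ, |P ξ| ≤ B * Real.cosh ξ ^ n

theorem isCoshBounded_const (a : ℝ) : IsCoshBounded fun _ => a :=
  ⟨continuous_const, |a|, 0, fun ξ => by simp⟩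

theorem isCoshBounded_cosh : IsCoshBounded Real.cosh :=
  ⟨Real.continuous_cosh, 1, 1, fun ξ => by simp [abs_of_pos (Real.cosh_pos ξ)]⟩

theorem isCoshBounded_sinh : IsCoshBounded Real.sinh := by
  refine ⟨Real.continuous_sinh, 1, 1, fun ξ => ?_⟩
  rw [one_mul, pow_one]
  exact abs_le_of_sq_le_sq (by rw [Real.cosh_sq]; linarith) (Real.cosh_pos ξ).le

theorem IsCoshBounded.mul {P Q : ℝ → ℝ} (hP : IsCoshBounded P) (hQ : IsCoshBounded Q) :
    IsCoshBounded fun ξ => P ξ * Q ξ := by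
  obtain ⟨hPc, B, n, hB⟩ := hP
  obtain ⟨hQc, D, m, hD⟩ := hQ
  refine ⟨hPc.mul hQc, B * D, n + m, fun ξ => ?_⟩
  rw [abs_mul]
  calc |P ξ| * |Q ξ| ≤ (B * Real.cosh ξ ^ n) * (D * Real.cosh ξ ^ m) :=
        mul_le_mul (hB ξ) (hD ξ) (abs_nonneg _) ((abs_nonneg _).trans (hB ξ))
    _ = _ := by ring

theorem IsCoshBounded.add {P Q : ℝ → ℝ} (hP : IsCoshBounded P) (hQ : IsCoshBounded Q) :
    IsCoshBounded fun ξ => P ξ + Q ξ := by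
  obtain ⟨hPc, B, n, hB⟩ := hP
  obtain ⟨hQc, D, m, hD⟩ := hQ
  refine ⟨hPc.add hQc, |B| + |D|, n + m, fun ξ => (abs_add_le _ _).trans ?_⟩
  have h1 := Real.one_le_cosh ξ
  have e1 : B * Real.cosh ξ ^ n ≤ |B| * Real.cosh ξ ^ (n + m) := by
    gcongr
    · exact le_abs_self B
    · omega
  have e2 : D * Real.cosh ξ ^ m ≤ |D| * Real.cosh ξ ^ (n + m) := by
    gcongr
    · exact le_abs_self D
    · omega
  have := hB ξ
  have := hD ξ
  linarith

theorem IsCoshBounded.const_mul {P : ℝ → ℝ} (hP : IsCoshBounded P) (a : ℝ) :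
    IsCoshBounded fun ξ => a * P ξ := (isCoshBounded_const a).mul hP

/-- The kernel `e^{-(x/2) cosh ξ} P(ξ) G(x (1 + cosh ξ) / 2)`. -/
noncomputable def coshKernel (P G : ℝ → ℝ) (x ξ : ℝ) : ℝ :=
  Real.exp (-(x / 2 * Real.cosh ξ)) * P ξ * G (x / 2 * (1 + Real.cosh ξ))

theorem continuous_coshKernel {P G : ℝ → ℝ} (hP : IsCoshBounded P) (hG : IsAmplitude G) {x : ℝ}
    (hx : 0 < x) : Continuous (coshKernel P G x) := by
  have h1 : Continuous fun ξ => G (x / 2 * (1 + Real.cosh ξ)) := by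
    refine hG.continuousOn.comp_continuous (by fun_prop) fun ξ => ?_
    have := Real.cosh_pos ξ
    show 0 < x / 2 * (1 + Real.cosh ξ)
    positivity
  have h2 := hP.continuous
  exact ((by fun_prop : Continuous fun ξ => Real.exp (-(x / 2 * Real.cosh ξ))).mul h2).mul h1

/-- Half of the exponent (ε/2) cosh ξ absorbs the powers of cosh coming from P and G; the other half
is at least εξ²/8 since cosh ξ ≥ 1 + ξ²/2. Uniformity in x is what allows differentiation under the
integral sign. -/
theorem exists_coshKernel_le {P G : ℝ → ℝ} (hP : IsCoshBounded P) (hG : IsAmplitude G) {ε : ℝ}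
    (hε : 0 < ε) (M : ℝ) :
    ∃ C, ∀ x ∈ Icc ε M, ∀ ξ, |coshKernel P G x ξ| ≤ C * Real.exp (-(ε / 8) * ξ ^ 2) := by
  obtain ⟨-, B, n, hB⟩ := hP
  obtain ⟨C, N, hC⟩ := hG.growth ε hε
  have hC0 : 0 ≤ C := by
    have := (abs_nonneg _).trans (hC ε le_rfl)
    exact nonneg_of_mul_nonneg_left this (by positivity)
  have hB0 : 0 ≤ B := by
    have := (abs_nonneg _).trans (hB 0)
    simpa using this
  refine ⟨B * (C * (1 + M) ^ N) * ((n + N).factorial / (ε / 4) ^ (n + N)), fun x hx ξ => ?_⟩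
  set c := Real.cosh ξ with hc
  have hc1 : 1 ≤ c := Real.one_le_cosh ξ
  have hx0 : 0 < x := hε.trans_le hx.1
  have hM : x ≤ M := hx.2
  have hεx : ε ≤ x := hx.1
  -- The argument of G is at least x ≥ ε, so the growth bound applies, and 1 plus the argument is at
  -- most (1 + M) cosh ξ.
  have g1 : |G (x / 2 * (1 + c))| ≤ C * (1 + M) ^ N * c ^ N := by
    refine (hC _ (by nlinarith)).trans ?_
    rw [mul_assoc, ← mul_pow]
    gcongr
    nlinarith
  have g2 := cosh_pow_le (n + N) (ε := ε / 4) (by positivity) ξ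
  rw [← hc] at g2
  have g3 := one_add_sq_div_two_le_cosh ξ
  rw [← hc] at g3
  have hM0 : 0 < 1 + M := by linarith
  calc |coshKernel P G x ξ|
      = Real.exp (-(x / 2 * c)) * |P ξ| * |G (x / 2 * (1 + c))| := by
        rw [coshKernel, abs_mul, abs_mul, abs_of_pos (Real.exp_pos _)]
    _ ≤ Real.exp (-(ε / 2 * c)) * (B * c ^ n) * (C * (1 + M) ^ N * c ^ N) := by
        gcongr
        exact hB ξ
    _ = B * (C * (1 + M) ^ N) * (c ^ (n + N) * Real.exp (-(ε / 2 * c))) := by ring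
    _ ≤ B * (C * (1 + M) ^ N) * ((n + N).factorial / (ε / 4) ^ (n + N) * Real.exp (ε / 4 * c)
          * Real.exp (-(ε / 2 * c))) := by gcongr
    _ = B * (C * (1 + M) ^ N) * ((n + N).factorial / (ε / 4) ^ (n + N))
          * Real.exp (-(ε / 4) * c) := by
        rw [mul_assoc (_ / _), ← Real.exp_add]
        ring_nf
    _ ≤ _ := by
        refine mul_le_mul_of_nonneg_left (Real.exp_le_exp.2 ?_) (by positivity)
        nlinarith

theorem integrable_coshKernel {P G : ℝ → ℝ} (hP : IsCoshBounded P) (hG : IsAmplitude G) {x : ℝ}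
    (hx : 0 < x) : Integrable (coshKernel P G x) := by
  obtain ⟨C, hC⟩ := exists_coshKernel_le hP hG hx x
  refine Integrable.mono' ((integrable_exp_neg_mul_sq (by positivity : 0 < x / 8)).const_mul C)
    (continuous_coshKernel hP hG hx).aestronglyMeasurable (Eventually.of_forall fun ξ => ?_)
  exact hC x ⟨le_rfl, le_rfl⟩ ξ

theorem norm_cexp_I_mul (τ ξ : ℝ) : ‖Complex.exp (Complex.I * τ * ξ)‖ = 1 := by
  have : Complex.I * τ * ξ = ((τ * ξ : ℝ) : ℂ) * Complex.I := by push_cast; ring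
  rw [this, Complex.norm_exp_ofReal_mul_I]

theorem norm_ofReal_mul_cexp (a τ ξ : ℝ) :
    ‖(a : ℂ) * Complex.exp (Complex.I * τ * ξ)‖ = |a| := by
  rw [norm_mul, norm_cexp_I_mul, mul_one, Complex.norm_real, Real.norm_eq_abs]

theorem integrable_coshKernel_mul_cexp {P G : ℝ → ℝ} (hP : IsCoshBounded P) (hG : IsAmplitude G)
    {x : ℝ} (hx : 0 < x) (τ : ℝ) :
    Integrable fun ξ : ℝ => (coshKernel P G x ξ : ℂ) * Complex.exp (Complex.I * τ * ξ) := by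
  refine Integrable.mono' (integrable_coshKernel hP hG hx).abs ?_
    (Eventually.of_forall fun ξ => (norm_ofReal_mul_cexp _ τ ξ).le)
  have := continuous_coshKernel hP hG hx
  exact (by fun_prop : Continuous _).aestronglyMeasurable

/-- The Fourier integral of `coshKernel`. -/
noncomputable def coshFourier (P G : ℝ → ℝ) (τ x : ℝ) : ℂ :=
  ∫ ξ : ℝ, (coshKernel P G x ξ : ℂ) * Complex.exp (Complex.I * τ * ξ)

theorem norm_coshFourier_le (P G : ℝ → ℝ) (τ x : ℝ) :
    ‖coshFourier P G τ x‖ ≤ ∫ ξ, |coshKernel P G x ξ| := by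
  refine (norm_integral_le_integral_norm _).trans (le_of_eq ?_)
  simp only [norm_ofReal_mul_cexp]

theorem continuous_coshFourier {P G : ℝ → ℝ} (hP : IsCoshBounded P) (hG : IsAmplitude G)
    {x : ℝ} (hx : 0 < x) : Continuous fun τ => coshFourier P G τ x := by
  refine continuous_of_dominated
    (fun τ => (integrable_coshKernel_mul_cexp hP hG hx τ).aestronglyMeasurable)
    (fun τ => Eventually.of_forall fun ξ => (norm_ofReal_mul_cexp _ τ ξ).le)
    (integrable_coshKernel hP hG hx).abs (Eventually.of_forall fun ξ => ?_)
  fun_prop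

theorem coshFourier_const_mul (P G : ℝ → ℝ) (a τ x : ℝ) :
    coshFourier (fun ξ => a * P ξ) G τ x = a * coshFourier P G τ x := by
  rw [coshFourier, coshFourier, ← integral_const_mul]
  congr 1
  ext ξ
  simp only [coshKernel]
  push_cast
  ring

theorem coshFourier_add {P Q G : ℝ → ℝ} (hP : IsCoshBounded P) (hQ : IsCoshBounded Q)
    (hG : IsAmplitude G) {x : ℝ} (hx : 0 < x) (τ : ℝ) :
    coshFourier (fun ξ => P ξ + Q ξ) G τ x = coshFourier P G τ x + coshFourier Q G τ x := by
  rw [coshFourier, coshFourier, coshFourier, ← integral_add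
    (integrable_coshKernel_mul_cexp hP hG hx τ) (integrable_coshKernel_mul_cexp hQ hG hx τ)]
  congr 1
  ext ξ
  simp only [coshKernel]
  push_cast
  ring

theorem hasDerivAt_coshKernel {P G G' : ℝ → ℝ} (hd : ∀ y, 0 < y → HasDerivAt G (G' y) y) {x : ℝ}
    (hx : 0 < x) (ξ : ℝ) : HasDerivAt (fun x => coshKernel P G x ξ)
      (coshKernel (fun ξ => -(1 / 2) * (Real.cosh ξ * P ξ)) G x ξ +
        coshKernel (fun ξ => 1 / 2 * ((1 + Real.cosh ξ) * P ξ)) G' x ξ) x := by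
  have hc := Real.cosh_pos ξ
  have h1 : HasDerivAt (fun x : ℝ => -(x / 2 * Real.cosh ξ)) (-(1 / 2 * Real.cosh ξ)) x :=
    (((hasDerivAt_id x).div_const 2).mul_const _).fun_neg
  have h2 : HasDerivAt (fun x : ℝ => x / 2 * (1 + Real.cosh ξ)) (1 / 2 * (1 + Real.cosh ξ)) x :=
    ((hasDerivAt_id x).div_const 2).mul_const _
  have h3 := (hd (x / 2 * (1 + Real.cosh ξ)) (by positivity)).comp x h2
  refine ((h1.exp.mul_const (P ξ)).mul h3).congr_deriv ?_
  simp only [coshKernel, Function.comp]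
  ring

theorem hasDerivAt_coshFourier {P G G' : ℝ → ℝ} (hP : IsCoshBounded P) (hG : IsAmplitude G)
    (hG' : IsAmplitude G') (hd : ∀ y, 0 < y → HasDerivAt G (G' y) y) {x : ℝ} (hx : 0 < x) (τ : ℝ) :
    HasDerivAt (coshFourier P G τ)
      (coshFourier (fun ξ => -(1 / 2) * (Real.cosh ξ * P ξ)) G τ x +
        coshFourier (fun ξ => 1 / 2 * ((1 + Real.cosh ξ) * P ξ)) G' τ x) x := by
  have hP1 : IsCoshBounded (fun ξ => -(1 / 2) * (Real.cosh ξ * P ξ)) :=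
    (isCoshBounded_cosh.mul hP).const_mul _
  have hP2 : IsCoshBounded (fun ξ => 1 / 2 * ((1 + Real.cosh ξ) * P ξ)) :=
    (((isCoshBounded_const 1).add isCoshBounded_cosh).mul hP).const_mul _
  obtain ⟨C1, hC1⟩ := exists_coshKernel_le hP1 hG (by positivity : 0 < x / 2) (2 * x)
  obtain ⟨C2, hC2⟩ := exists_coshKernel_le hP2 hG' (by positivity : 0 < x / 2) (2 * x)
  have i1 := integrable_coshKernel_mul_cexp hP1 hG hx τ
  have i2 := integrable_coshKernel_mul_cexp hP2 hG' hx τ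
  have h := hasDerivAt_integral_of_dominated_loc_of_deriv_le (μ := volume) (𝕜 := ℝ) (x₀ := x)
    (s := Icc (x / 2) (2 * x))
    (F := fun x ξ => (coshKernel P G x ξ : ℂ) * Complex.exp (Complex.I * τ * ξ))
    (F' := fun x ξ => ((coshKernel (fun ξ => -(1 / 2) * (Real.cosh ξ * P ξ)) G x ξ : ℝ) : ℂ) *
        Complex.exp (Complex.I * τ * ξ) +
      ((coshKernel (fun ξ => 1 / 2 * ((1 + Real.cosh ξ) * P ξ)) G' x ξ : ℝ) : ℂ) *
        Complex.exp (Complex.I * τ * ξ))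
    (bound := fun ξ => C1 * Real.exp (-(x / 2 / 8) * ξ ^ 2) + C2 * Real.exp (-(x / 2 / 8) * ξ ^ 2))
    (Icc_mem_nhds (by linarith) (by linarith)) ?_ (integrable_coshKernel_mul_cexp hP hG hx τ)
    (i1.add i2).aestronglyMeasurable ?_ ?_ ?_
  · have h2 := h.2
    rw [integral_add i1 i2] at h2
    exact h2
  · filter_upwards [Ioi_mem_nhds hx] with y hy
    exact (integrable_coshKernel_mul_cexp hP hG hy τ).aestronglyMeasurable
  · refine Eventually.of_forall fun ξ y hy => (norm_add_le _ _).trans ?_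
    rw [norm_ofReal_mul_cexp, norm_ofReal_mul_cexp]
    exact add_le_add (hC1 y hy ξ) (hC2 y hy ξ)
  · have hg := integrable_exp_neg_mul_sq (by positivity : 0 < x / 2 / 8)
    exact (hg.const_mul C1).add (hg.const_mul C2)
  · refine Eventually.of_forall fun ξ y hy => ?_
    have hy0 : 0 < y := lt_of_lt_of_le (by positivity) hy.1
    refine ((hasDerivAt_coshKernel (P := P) hd hy0 ξ).ofReal_comp.mul_const _).congr_deriv ?_
    push_cast
    ring

/-- Integration by parts in `coshFourier`. -/
theorem coshFourier_integral_by_parts {P P' G G' : ℝ → ℝ} (hP : IsCoshBounded P)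
    (hP' : IsCoshBounded P') (hPd : ∀ ξ, HasDerivAt P (P' ξ) ξ) (hG : IsAmplitude G)
    (hG' : IsAmplitude G') (hd : ∀ y, 0 < y → HasDerivAt G (G' y) y) {x : ℝ} (hx : 0 < x) (τ : ℝ) :
    Complex.I * τ * coshFourier P G τ x = -(coshFourier P' G τ x +
      x / 2 * (coshFourier (fun ξ => Real.sinh ξ * P ξ) G' τ x -
        coshFourier (fun ξ => Real.sinh ξ * P ξ) G τ x)) := by
  have hS : IsCoshBounded fun ξ => Real.sinh ξ * P ξ := isCoshBounded_sinh.mul hP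
  have i1 := integrable_coshKernel_mul_cexp hP' hG hx τ
  have i2 := integrable_coshKernel_mul_cexp hS hG' hx τ
  have i3 := integrable_coshKernel_mul_cexp hS hG hx τ
  have i0 := integrable_coshKernel_mul_cexp hP hG hx τ
  have hk : ∀ ξ, HasDerivAt (fun ξ => (coshKernel P G x ξ : ℂ))
      ((coshKernel P' G x ξ : ℂ) +
        x / 2 * (coshKernel (fun ξ => Real.sinh ξ * P ξ) G' x ξ -
          coshKernel (fun ξ => Real.sinh ξ * P ξ) G x ξ)) ξ := by
    intro ξ
    have hc := Real.cosh_pos ξ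
    have h1 : HasDerivAt (fun ξ : ℝ => -(x / 2 * Real.cosh ξ)) (-(x / 2 * Real.sinh ξ)) ξ :=
      ((Real.hasDerivAt_cosh ξ).const_mul _).fun_neg
    have h2 : HasDerivAt (fun ξ : ℝ => x / 2 * (1 + Real.cosh ξ)) (x / 2 * Real.sinh ξ) ξ :=
      ((Real.hasDerivAt_cosh ξ).const_add 1).const_mul _
    have h3 := (hd (x / 2 * (1 + Real.cosh ξ)) (by positivity)).comp ξ h2
    refine ((h1.exp.mul (hPd ξ)).mul h3).ofReal_comp.congr_deriv ?_
    simp only [coshKernel, Function.comp, Pi.mul_apply]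
    push_cast
    ring
  have he : ∀ ξ : ℝ, HasDerivAt (fun ξ : ℝ => Complex.exp (Complex.I * τ * ξ))
      (Complex.I * τ * Complex.exp (Complex.I * τ * ξ)) ξ := by
    intro ξ
    have h1 : HasDerivAt (fun ξ : ℝ => Complex.I * τ * (ξ : ℂ)) (Complex.I * τ) ξ := by
      simpa using (HasDerivAt.ofReal_comp (hasDerivAt_id ξ)).const_mul (Complex.I * τ)
    refine h1.cexp.congr_deriv ?_
    ring
  have i4 : Integrable fun ξ : ℝ => ((coshKernel P' G x ξ : ℂ) +
        x / 2 * (coshKernel (fun ξ => Real.sinh ξ * P ξ) G' x ξ -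
          coshKernel (fun ξ => Real.sinh ξ * P ξ) G x ξ)) * Complex.exp (Complex.I * τ * ξ) := by
    refine (i1.add ((i2.sub i3).const_mul ((x : ℂ) / 2))).congr (Eventually.of_forall fun ξ => ?_)
    simp only [Pi.add_apply, Pi.sub_apply]
    ring
  have i5 : Integrable fun ξ : ℝ => (coshKernel P G x ξ : ℂ) *
      (Complex.I * τ * Complex.exp (Complex.I * τ * ξ)) := by
    refine (i0.const_mul (Complex.I * τ)).congr (Eventually.of_forall fun ξ => ?_)
    ring
  have key := integral_mul_deriv_eq_deriv_mul_of_integrable (fun ξ _ => hk ξ) (fun ξ _ => he ξ)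
    i5 i4 i0
  have e1 : Complex.I * τ * coshFourier P G τ x = ∫ ξ : ℝ, (coshKernel P G x ξ : ℂ) *
      (Complex.I * τ * Complex.exp (Complex.I * τ * ξ)) := by
    rw [coshFourier, ← integral_const_mul]
    congr 1
    ext ξ
    ring
  rw [e1, key, coshFourier, coshFourier, coshFourier, ← integral_sub i2 i3, ← integral_const_mul]
  refine congrArg Neg.neg (Eq.trans (integral_congr_ae (Eventually.of_forall fun ξ => ?_))
    (integral_add i1 ((i2.sub i3).const_mul ((x : ℂ) / 2))))
  ring_nf

/-! ### Whittaker's equation for the zeroth moment. -/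

theorem rpow_le_one_add_pow {y p : ℝ} (hy : 1 ≤ y) : y ^ p ≤ (1 + y) ^ ⌈|p|⌉₊ := by
  rw [← Real.rpow_natCast]
  calc y ^ p ≤ y ^ (⌈|p|⌉₊ : ℝ) :=
        Real.rpow_le_rpow_of_exponent_le hy ((le_abs_self p).trans (Nat.le_ceil _))
    _ ≤ _ := Real.rpow_le_rpow (by linarith) (by linarith) (by positivity)

/-- Compactness bounds G on [ε, Z], and the limit bounds it by a multiple of s^p beyond Z. -/
theorem isAmplitude_of_tendsto {G : ℝ → ℝ} {p l : ℝ} (hc : ContinuousOn G (Ioi 0))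
    (h : Tendsto (fun y => G y / y ^ p) atTop (𝓝 l)) : IsAmplitude G := by
  refine ⟨hc, fun ε hε => ?_⟩
  obtain ⟨Y, hY⟩ := eventually_atTop.1 (h.norm.eventually_lt_const (lt_add_one ‖l‖))
  set Z := max Y 1
  obtain ⟨C, hC⟩ := (isCompact_Icc (a := ε) (b := Z)).exists_bound_of_continuousOn
    (hc.mono fun t ht => lt_of_lt_of_le hε ht.1)
  refine ⟨|C| + (‖l‖ + 1), ⌈|p|⌉₊, fun s hs => ?_⟩
  have hs0 : 0 < s := hε.trans_le hs
  have hpow : (1 : ℝ) ≤ (1 + s) ^ ⌈|p|⌉₊ := one_le_pow₀ (by linarith)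
  have hl := norm_nonneg l
  rcases le_total s Z with hsZ | hsZ
  · have h1 : |G s| ≤ |C| := (hC s ⟨hs, hsZ⟩).trans (le_abs_self C)
    nlinarith [abs_nonneg C]
  · have h1 := (hY s ((le_max_left _ _).trans hsZ)).le
    have h2 : (1 : ℝ) ≤ s := (le_max_right _ _).trans hsZ
    have h3 : 0 < s ^ p := by positivity
    rw [norm_div, Real.norm_of_nonneg h3.le, div_le_iff₀ h3, Real.norm_eq_abs] at h1
    calc |G s| ≤ (‖l‖ + 1) * s ^ p := h1
      _ ≤ (‖l‖ + 1) * (1 + s) ^ ⌈|p|⌉₊ := by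
          gcongr
          exact rpow_le_one_add_pow h2
      _ ≤ _ := by nlinarith [abs_nonneg C]

/-- The second derivative of the Tricomi function, as given by its differential equation. -/
noncomputable def tricomiSecondDeriv (μ : ℝ) (H H' : ℝ → ℝ) (y : ℝ) : ℝ :=
  ((y - 1 / 2) * H' y - μ * H y) / y

section Tricomi

variable {μ : ℝ} {H H' : ℝ → ℝ}

theorem IsTricomi.continuousOn (h : IsTricomi μ H H') : ContinuousOn H (Ioi 0) :=
  fun y hy => (h.hasDerivAt y hy).continuousAt.continuousWithinAt

theorem IsTricomi.continuousOn' (h : IsTricomi μ H H') : ContinuousOn H' (Ioi 0) :=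
  fun y hy => (h.hasDerivAt' y hy).continuousAt.continuousWithinAt

theorem IsTricomi.isAmplitude (h : IsTricomi μ H H') : IsAmplitude H :=
  isAmplitude_of_tendsto h.continuousOn h.tendsto

theorem IsTricomi.isAmplitude' (h : IsTricomi μ H H') : IsAmplitude H' :=
  isAmplitude_of_tendsto h.continuousOn' h.tendsto'

theorem IsTricomi.isAmplitude_second (h : IsTricomi μ H H') :
    IsAmplitude (tricomiSecondDeriv μ H H') := by
  refine isAmplitude_of_tendsto (p := μ) (l := 0) ?_ ?_
  · refine (((continuousOn_id.sub continuousOn_const).mul h.continuousOn').sub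
      (continuousOn_const.mul h.continuousOn)).div continuousOn_id fun y hy => ne_of_gt hy
  · have h1 : Tendsto (fun y : ℝ => (1 - 1 / 2 * y⁻¹) * (H' y / y ^ μ) -
        μ * y⁻¹ * (H y / y ^ μ)) atTop (𝓝 0) := by
      have hinv := tendsto_inv_atTop_zero (𝕜 := ℝ)
      have := (((hinv.const_mul (1 / 2)).const_sub 1).mul h.tendsto').sub
        ((hinv.const_mul μ).mul h.tendsto)
      simpa using this
    refine h1.congr' ?_
    filter_upwards [eventually_gt_atTop 0] with y hy
    have := (Real.rpow_pos_of_pos hy μ).ne'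
    rw [tricomiSecondDeriv]
    field_simp

/-- The moments `∫ e^{-(x/2) cosh ξ} cosh ξ ^ n G(x (1 + cosh ξ) / 2) e^{iτξ} dξ`. -/
noncomputable def coshMoment (n : ℕ) (G : ℝ → ℝ) (τ x : ℝ) : ℂ :=
  coshFourier (fun ξ => Real.cosh ξ ^ n) G τ x

theorem isCoshBounded_cosh_pow (n : ℕ) : IsCoshBounded fun ξ => Real.cosh ξ ^ n :=
  ⟨by fun_prop, 1, n, fun ξ => by
    have := Real.cosh_pos ξ
    rw [one_mul, abs_of_pos (by positivity)]⟩

theorem hasDerivAt_coshMoment {G G' : ℝ → ℝ} (n : ℕ) (hG : IsAmplitude G)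
    (hG' : IsAmplitude G') (hd : ∀ y, 0 < y → HasDerivAt G (G' y) y) {x : ℝ} (hx : 0 < x) (τ : ℝ) :
    HasDerivAt (coshMoment n G τ) (-(1 / 2) * coshMoment (n + 1) G τ x +
      1 / 2 * (coshMoment n G' τ x + coshMoment (n + 1) G' τ x)) x := by
  refine (hasDerivAt_coshFourier (isCoshBounded_cosh_pow n) hG hG' hd hx τ).congr_deriv ?_
  rw [coshFourier_const_mul, coshFourier_const_mul]
  have e1 : (fun ξ => Real.cosh ξ * Real.cosh ξ ^ n) = fun ξ => Real.cosh ξ ^ (n + 1) := by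
    ext ξ; ring
  have e2 : (fun ξ => (1 + Real.cosh ξ) * Real.cosh ξ ^ n) =
      fun ξ => Real.cosh ξ ^ n + Real.cosh ξ ^ (n + 1) := by
    ext ξ; ring
  rw [e1, e2, coshFourier_add (isCoshBounded_cosh_pow n) (isCoshBounded_cosh_pow (n + 1)) hG' hx]
  simp only [coshMoment]
  push_cast
  ring

/-- First of the two integrations by parts that express (iτ)² times the zeroth moment; the weight 1
turns into sinh, and the next lemma returns to powers of cosh through sinh² = cosh² - 1. -/
theorem I_mul_coshMoment_zero {G G' : ℝ → ℝ} (hG : IsAmplitude G)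
    (hG' : IsAmplitude G') (hd : ∀ y, 0 < y → HasDerivAt G (G' y) y) {x : ℝ} (hx : 0 < x) (τ : ℝ) :
    Complex.I * τ * coshMoment 0 G τ x =
      -(x / 2 * (coshFourier Real.sinh G' τ x - coshFourier Real.sinh G τ x)) := by
  have := coshFourier_integral_by_parts (P := fun _ => 1) (P' := fun _ => 0)
    (isCoshBounded_const 1) (isCoshBounded_const 0) (fun ξ => hasDerivAt_const ξ 1) hG hG' hd hx τ
  have e0 : coshFourier (fun _ => 0) G τ x = 0 := by
    simp [coshFourier, coshKernel]
  simpa [coshMoment, e0] using this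

theorem I_mul_coshFourier_sinh {G G' : ℝ → ℝ} (hG : IsAmplitude G)
    (hG' : IsAmplitude G') (hd : ∀ y, 0 < y → HasDerivAt G (G' y) y) {x : ℝ} (hx : 0 < x) (τ : ℝ) :
    Complex.I * τ * coshFourier Real.sinh G τ x =
      -(coshMoment 1 G τ x + x / 2 * (coshMoment 2 G' τ x - coshMoment 0 G' τ x -
        (coshMoment 2 G τ x - coshMoment 0 G τ x))) := by
  have h := coshFourier_integral_by_parts isCoshBounded_sinh isCoshBounded_cosh
    Real.hasDerivAt_sinh hG hG' hd hx τ
  have e : (fun ξ => Real.sinh ξ * Real.sinh ξ) =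
      fun ξ => Real.cosh ξ ^ 2 + (-1) * Real.cosh ξ ^ 0 := by
    ext ξ
    rw [Real.cosh_sq]
    ring
  have e1 : Real.cosh = fun ξ => Real.cosh ξ ^ 1 := by
    ext ξ; ring
  rw [e, coshFourier_add (isCoshBounded_cosh_pow 2) ((isCoshBounded_cosh_pow 0).const_mul _) hG' hx,
    coshFourier_add (isCoshBounded_cosh_pow 2) ((isCoshBounded_cosh_pow 0).const_mul _) hG hx,
    coshFourier_const_mul, coshFourier_const_mul, e1] at h
  rw [h]
  simp only [coshMoment]
  push_cast
  ring_nf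

/-- Tricomi's equation y H'' = (y - 1/2) H' - μ H at y = x(1 + cosh ξ)/2, integrated against
e^{-(x/2) cosh ξ} e^{iτξ}. -/
theorem IsTricomi.coshMoment_second (h : IsTricomi μ H H') {x : ℝ} (hx : 0 < x) (τ : ℝ) :
    x / 2 * (coshMoment 0 (tricomiSecondDeriv μ H H') τ x +
      coshMoment 1 (tricomiSecondDeriv μ H H') τ x) =
    x / 2 * (coshMoment 0 H' τ x + coshMoment 1 H' τ x) - 1 / 2 * coshMoment 0 H' τ x -
      μ * coshMoment 0 H τ x := by
  have i1 := fun n => integrable_coshKernel_mul_cexp (isCoshBounded_cosh_pow n)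
    h.isAmplitude_second hx τ
  have i2 := fun n => integrable_coshKernel_mul_cexp (isCoshBounded_cosh_pow n)
    h.isAmplitude' hx τ
  have i3 := fun n => integrable_coshKernel_mul_cexp (isCoshBounded_cosh_pow n)
    h.isAmplitude hx τ
  simp only [coshMoment, coshFourier]
  have j2 := ((i2 0).add (i2 1)).const_mul ((x : ℂ) / 2)
  have j3 := (i2 0).const_mul (1 / 2 : ℂ)
  have j4 := (i3 0).const_mul (μ : ℂ)
  have e2 := integral_sub j2 j3
  have e3 := integral_sub (j2.sub j3) j4
  simp only [Pi.add_apply, Pi.sub_apply] at e2 e3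
  rw [e2, integral_const_mul, integral_const_mul, integral_const_mul,
    integral_add (i2 0) (i2 1)] at e3
  rw [← e3, ← integral_add (i1 0) (i1 1), ← integral_const_mul]
  refine integral_congr_ae (Eventually.of_forall fun ξ => ?_)
  have hc := Real.cosh_pos ξ
  have e : x / 2 * (coshKernel (fun ξ => Real.cosh ξ ^ 0) (tricomiSecondDeriv μ H H') x ξ +
      coshKernel (fun ξ => Real.cosh ξ ^ 1) (tricomiSecondDeriv μ H H') x ξ) =
      x / 2 * (coshKernel (fun ξ => Real.cosh ξ ^ 0) H' x ξ +
        coshKernel (fun ξ => Real.cosh ξ ^ 1) H' x ξ) -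
      1 / 2 * coshKernel (fun ξ => Real.cosh ξ ^ 0) H' x ξ -
      μ * coshKernel (fun ξ => Real.cosh ξ ^ 0) H x ξ := by
    simp only [coshKernel, tricomiSecondDeriv]
    field_simp
  have e' := congrArg (fun r : ℝ => (r : ℂ)) e
  push_cast at e'
  simp only
  linear_combination Complex.exp (Complex.I * τ * ξ) * e'

theorem sqrt_hasDerivAt_ofReal {x : ℝ} (hx : 0 < x) :
    HasDerivAt (fun x : ℝ => (Real.sqrt x : ℂ)) ((Real.sqrt x : ℂ) / (2 * x)) x := by
  refine (Real.hasDerivAt_sqrt hx.ne').ofReal_comp.congr_deriv ?_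
  have h : (Real.sqrt x : ℝ) ≠ 0 := (Real.sqrt_pos.2 hx).ne'
  have e : (1 / (2 * Real.sqrt x) : ℝ) = Real.sqrt x / (2 * x) := by
    rw [div_eq_div_iff (by positivity) (by positivity)]
    nlinarith [Real.mul_self_sqrt hx.le]
  rw [e]
  push_cast
  ring

theorem IsTricomi.whittaker_ode (h : IsTricomi μ H H') (κ : ℂ) (τ : ℝ) :
    ∃ u' : ℝ → ℂ, ∀ x : ℝ, 0 < x →
      HasDerivAt (fun x => κ * Real.sqrt x * coshMoment 0 H τ x) (u' x) x ∧
      HasDerivAt u' (-((-(1 / 4 : ℂ) + (μ : ℂ) / (x : ℂ) +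
        (1 / 4 - (Complex.I * τ) ^ 2) / (x : ℂ) ^ 2) *
          (κ * Real.sqrt x * coshMoment 0 H τ x))) x := by
  set H'' := tricomiSecondDeriv μ H H' with hH''
  have hd : ∀ y, 0 < y → HasDerivAt H (H' y) y := h.hasDerivAt
  have hd' : ∀ y, 0 < y → HasDerivAt H' (H'' y) y := h.hasDerivAt'
  have a0 := h.isAmplitude
  have a1 := h.isAmplitude'
  have a2 : IsAmplitude H'' := h.isAmplitude_second
  have dF : ∀ x, 0 < x → HasDerivAt (coshMoment 0 H τ) (-(1 / 2) * coshMoment 1 H τ x +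
      1 / 2 * (coshMoment 0 H' τ x + coshMoment 1 H' τ x)) x := fun x hx =>
    hasDerivAt_coshMoment 0 a0 a1 hd hx τ
  have dF2 := fun x (hx : 0 < x) =>
    ((hasDerivAt_coshMoment 1 a0 a1 hd hx τ).const_mul (-(1 / 2) : ℂ)).add
      (((hasDerivAt_coshMoment 0 a1 a2 hd' hx τ).add
        (hasDerivAt_coshMoment 1 a1 a2 hd' hx τ)).const_mul (1 / 2 : ℂ))
  refine ⟨fun x => κ * ((Real.sqrt x : ℂ) / (2 * x)) * coshMoment 0 H τ x +
    κ * Real.sqrt x * (-(1 / 2) * coshMoment 1 H τ x +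
      1 / 2 * (coshMoment 0 H' τ x + coshMoment 1 H' τ x)), fun x hx => ⟨?_, ?_⟩⟩
  · exact ((sqrt_hasDerivAt_ofReal hx).const_mul κ).mul (dF x hx)
  · have hx0 : (x : ℂ) ≠ 0 := Complex.ofReal_ne_zero.2 hx.ne'
    have hs2 : HasDerivAt (fun x : ℝ => (2 * (x : ℂ))) 2 x := by
      simpa using (HasDerivAt.ofReal_comp (hasDerivAt_id x)).const_mul (2 : ℂ)
    have d1 := (((sqrt_hasDerivAt_ofReal hx).div hs2 (by simp [hx.ne'])).const_mul κ).mul (dF x hx)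
    have d2 := ((sqrt_hasDerivAt_ofReal hx).const_mul κ).mul (dF2 x hx)
    refine (d1.add d2).congr_deriv ?_
    have r1 := I_mul_coshMoment_zero a0 a1 hd hx τ
    have r2 := I_mul_coshFourier_sinh a0 a1 hd hx τ
    have r3 := I_mul_coshFourier_sinh a1 a2 hd' hx τ
    have r4 := h.coshMoment_second hx τ
    rw [← hH''] at r4
    simp only [Pi.add_apply, Pi.div_apply, zero_add, Nat.reduceAdd]
    -- From here the claim is polynomial algebra: A, B, C are the moments of H, H', H'', and S0, S1
    -- the sinh integrals of H and H'.
    generalize coshMoment 0 H τ x = A0 at *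
    generalize coshMoment 1 H τ x = A1 at *
    generalize coshMoment 2 H τ x = A2 at *
    generalize coshMoment 0 H' τ x = B0 at *
    generalize coshMoment 1 H' τ x = B1 at *
    generalize coshMoment 2 H' τ x = B2 at *
    generalize coshMoment 0 H'' τ x = C0 at *
    generalize coshMoment 1 H'' τ x = C1 at *
    generalize coshMoment 2 H'' τ x = C2 at *
    generalize coshFourier Real.sinh H τ x = S0 at *
    generalize coshFourier Real.sinh H' τ x = S1 at *
    generalize (Real.sqrt x : ℂ) = s at *
    generalize (x : ℂ) = X at *
    have r5 : (Complex.I * τ) ^ 2 * A0 = X / 2 * ((B1 + X / 2 * (C2 - C0 - (B2 - B0))) -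
        (A1 + X / 2 * (B2 - B0 - (A2 - A0)))) := by
      linear_combination Complex.I * τ * r1 - X / 2 * (r3 - r2)
    field_simp
    -- Between the second x-derivative and (iτ)² A0 / X² all moments of order two cancel. Of the H''
    -- terms only (C0 + C1)/2 survives, which Tricomi's equation `r4` eliminates.
    linear_combination (-16 : ℂ) * κ * s * r5 + 16 * κ * s * X * r4

end Tricomi

/-! ### Asymptotics of the zeroth moment by Laplace's method. -/

/-- The expression equals x sinh²(η/(2√x)), the square of the difference quotient at 0 of t ↦
sinh(tη/2) with step t = 1/√x. -/
theorem tendsto_mul_cosh_sub_one (η : ℝ) :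
    Tendsto (fun x : ℝ => x / 2 * (Real.cosh ((Real.sqrt x)⁻¹ * η) - 1)) atTop
      (𝓝 (1 / 4 * η ^ 2)) := by
  have h1 : HasDerivAt (fun t : ℝ => Real.sinh (t * (η / 2))) (η / 2) 0 := by
    have := ((hasDerivAt_id (0 : ℝ)).mul_const (η / 2)).sinh
    simpa using this
  have h2 : Tendsto (fun x : ℝ => (Real.sqrt x)⁻¹) atTop (𝓝[≠] 0) := by
    refine tendsto_nhdsWithin_iff.2 ⟨tendsto_inv_atTop_zero.comp Real.tendsto_sqrt_atTop, ?_⟩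
    filter_upwards [eventually_gt_atTop 0] with x hx
    exact inv_ne_zero (Real.sqrt_pos.2 hx).ne'
  have h3 := ((hasDerivAt_iff_tendsto_slope_zero.1 h1).comp h2).pow 2
  have e : (η / 2) ^ 2 = 1 / 4 * η ^ 2 := by ring
  rw [e] at h3
  refine h3.congr' ?_
  filter_upwards [eventually_gt_atTop 0] with x hx
  have hc : Real.cosh ((Real.sqrt x)⁻¹ * η) = 2 * Real.sinh ((Real.sqrt x)⁻¹ * (η / 2)) ^ 2 + 1 := by
    have := Real.cosh_two_mul ((Real.sqrt x)⁻¹ * (η / 2))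
    rw [Real.cosh_sq] at this
    rw [show (Real.sqrt x)⁻¹ * η = 2 * ((Real.sqrt x)⁻¹ * (η / 2)) by ring, this]
    ring
  rw [hc]
  simp only [Function.comp, inv_inv, zero_add, smul_eq_mul, zero_mul, Real.sinh_zero, sub_zero,
    mul_pow, Real.sq_sqrt hx.le]
  ring

section Tricomi

variable {μ : ℝ} {H H' : ℝ → ℝ}

theorem tendsto_rescaled_coshKernel (hH : Tendsto (fun y => H y / y ^ μ) atTop (𝓝 1)) (η : ℝ) :
    Tendsto (fun x : ℝ => Real.exp (x / 2) / x ^ μ *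
      coshKernel (fun ξ => Real.cosh ξ ^ 0) H x ((Real.sqrt x)⁻¹ * η)) atTop
        (𝓝 (Real.exp (-(1 / 4) * η ^ 2))) := by
  have h1 : Tendsto (fun x : ℝ => Real.exp (-(x / 2 * (Real.cosh ((Real.sqrt x)⁻¹ * η) - 1)))) atTop
      (𝓝 (Real.exp (-(1 / 4 * η ^ 2)))) :=
    (Real.continuous_exp.tendsto _).comp (tendsto_mul_cosh_sub_one η).neg
  have h2 : Tendsto (fun x : ℝ => (1 + Real.cosh ((Real.sqrt x)⁻¹ * η)) / 2) atTop (𝓝 1) := by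
    have h3 : Tendsto (fun x : ℝ => (Real.sqrt x)⁻¹ * η) atTop (𝓝 0) := by
      simpa using (tendsto_inv_atTop_zero.comp Real.tendsto_sqrt_atTop).mul_const η
    have h4 := (((Real.continuous_cosh.tendsto 0).comp h3).const_add 1).div_const 2
    rw [Real.cosh_zero] at h4
    norm_num at h4
    exact h4
  have h5 : Tendsto (fun x : ℝ => x / 2 * (1 + Real.cosh ((Real.sqrt x)⁻¹ * η))) atTop atTop := by
    refine tendsto_atTop_mono' atTop ?_ tendsto_id
    filter_upwards [eventually_gt_atTop 0] with x hx
    have := Real.one_le_cosh ((Real.sqrt x)⁻¹ * η)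
    simp only [id]
    nlinarith
  have h6 := (h1.mul (hH.comp h5)).mul (h2.rpow_const (p := μ) (Or.inl one_ne_zero))
  rw [Real.one_rpow, mul_one, mul_one, ← neg_mul] at h6
  refine h6.congr' ?_
  filter_upwards [eventually_gt_atTop 0] with x hx
  have hc := Real.cosh_pos ((Real.sqrt x)⁻¹ * η)
  simp only [coshKernel, Function.comp]
  set c := Real.cosh ((Real.sqrt x)⁻¹ * η)
  have e1 : (x / 2 * (1 + c)) ^ μ = x ^ μ * ((1 + c) / 2) ^ μ := by
    rw [← Real.mul_rpow hx.le (by positivity)]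
    ring_nf
  have e2 : Real.exp (-(x / 2 * (c - 1))) = Real.exp (x / 2) * Real.exp (-(x / 2 * c)) := by
    rw [← Real.exp_add]
    ring_nf
  have n1 : x ^ μ ≠ 0 := by positivity
  have n2 : ((1 + c) / 2) ^ μ ≠ 0 := by positivity
  rw [e1, e2]
  field_simp

/-- A majorant independent of x for the dominated convergence in Laplace's method. H contributes at
most 2 x^μ cosh^N, and the power of cosh is absorbed by e^{(1/4) cosh}. -/
theorem exists_rescaled_coshKernel_le (hH : Tendsto (fun y => H y / y ^ μ) atTop (𝓝 1)) :
    ∃ C, ∀ᶠ x : ℝ in atTop, ∀ η : ℝ, |Real.exp (x / 2) / x ^ μ *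
      coshKernel (fun ξ => Real.cosh ξ ^ 0) H x ((Real.sqrt x)⁻¹ * η)| ≤
        C * Real.exp (-(1 / 8) * η ^ 2) := by
  obtain ⟨Y, hY⟩ := eventually_atTop.1 (hH.norm.eventually_lt_const
    (by norm_num : ‖(1 : ℝ)‖ < 2))
  set N := ⌈|μ|⌉₊
  refine ⟨2 * (N.factorial / (1 / 4) ^ N * Real.exp (1 / 4)), ?_⟩
  filter_upwards [eventually_ge_atTop Y, eventually_ge_atTop 1] with x hxY hx1 η
  have hx : 0 < x := by linarith
  have hc1 := Real.one_le_cosh ((Real.sqrt x)⁻¹ * η)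
  have hcq := one_add_sq_div_two_le_cosh ((Real.sqrt x)⁻¹ * η)
  have hcN := cosh_pow_le N (by norm_num : (0 : ℝ) < 1 / 4) ((Real.sqrt x)⁻¹ * η)
  rw [mul_pow, inv_pow, Real.sq_sqrt hx.le] at hcq
  simp only [coshKernel, pow_zero, mul_one]
  set c := Real.cosh ((Real.sqrt x)⁻¹ * η)
  have hs : x ≤ x / 2 * (1 + c) := by nlinarith
  have hs0 : 0 < x / 2 * (1 + c) := hx.trans_le hs
  have hq : η ^ 2 / 2 ≤ x * (c - 1) := by
    have : x * (x⁻¹ * η ^ 2 / 2) ≤ x * (c - 1) := by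
      apply mul_le_mul_of_nonneg_left _ hx.le
      linarith
    refine le_of_eq_of_le ?_ this
    field_simp
  have e1 : (x / 2 * (1 + c)) ^ μ = x ^ μ * ((1 + c) / 2) ^ μ := by
    rw [← Real.mul_rpow hx.le (by positivity)]
    ring_nf
  have hHs : |H (x / 2 * (1 + c))| ≤ 2 * (x ^ μ * c ^ N) := by
    have h1 := (hY _ (hxY.trans hs)).le
    have h2 : 0 < (x / 2 * (1 + c)) ^ μ := by positivity
    rw [norm_div, Real.norm_of_nonneg h2.le, div_le_iff₀ h2, Real.norm_eq_abs, e1] at h1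
    refine h1.trans ?_
    gcongr
    calc ((1 + c) / 2) ^ μ ≤ ((1 + c) / 2) ^ (N : ℝ) :=
          Real.rpow_le_rpow_of_exponent_le (by linarith)
            ((le_abs_self μ).trans (Nat.le_ceil _))
      _ = ((1 + c) / 2) ^ N := Real.rpow_natCast _ _
      _ ≤ c ^ N := by
          gcongr
          linarith
  have hxμ : 0 < x ^ μ := by positivity
  rw [abs_mul, abs_mul, abs_of_pos (by positivity : 0 < Real.exp (x / 2) / x ^ μ),
    abs_of_pos (Real.exp_pos _)]
  calc Real.exp (x / 2) / x ^ μ * (Real.exp (-(x / 2 * c)) * |H (x / 2 * (1 + c))|)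
      ≤ Real.exp (x / 2) / x ^ μ * (Real.exp (-(x / 2 * c)) * (2 * (x ^ μ *
          (N.factorial / (1 / 4) ^ N * Real.exp (1 / 4 * c))))) := by
        gcongr
        exact hHs.trans (by gcongr)
    _ = 2 * (N.factorial / (1 / 4) ^ N) *
          (Real.exp (x / 2) * Real.exp (-(x / 2 * c)) * Real.exp (1 / 4 * c)) := by
        field_simp
    _ = 2 * (N.factorial / (1 / 4) ^ N) *
          (Real.exp (1 / 4) * Real.exp (-(x / 2 * (c - 1)) + 1 / 4 * (c - 1))) := by
        rw [← Real.exp_add, ← Real.exp_add, ← Real.exp_add]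
        ring_nf
    _ ≤ 2 * (N.factorial / (1 / 4) ^ N) *
          (Real.exp (1 / 4) * Real.exp (-(1 / 8) * η ^ 2)) := by
        -- For x ≥ 1 one has x/2 - 1/4 ≥ x/4, and x(c - 1) ≥ η²/2.
        have : -(x / 2 * (c - 1)) + 1 / 4 * (c - 1) ≤ -(1 / 8) * η ^ 2 := by nlinarith
        gcongr
    _ = _ := by ring

/-- Under ξ = η/√x the kernel tends to e^{-η²/4} and the oscillating factor to 1, whatever τ is. The
Gaussian integral 2√π fixes the normalising constant of the representation of W. -/
theorem IsTricomi.tendsto_coshMoment (h : IsTricomi μ H H') (τ : ℝ) :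
    Tendsto (fun x : ℝ => ((Real.sqrt x * (Real.exp (x / 2) / x ^ μ) : ℝ) : ℂ) *
      coshMoment 0 H τ x) atTop (𝓝 ((2 * Real.sqrt Real.pi : ℝ) : ℂ)) := by
  have hlim : ((2 * Real.sqrt Real.pi : ℝ) : ℂ) =
      ∫ η : ℝ, ((Real.exp (-(1 / 4) * η ^ 2) : ℝ) : ℂ) := by
    rw [integral_complex_ofReal, integral_gaussian, Complex.ofReal_inj,
      show Real.pi / (1 / 4) = 2 ^ 2 * Real.pi by ring, Real.sqrt_mul (by norm_num),
      Real.sqrt_sq (by norm_num)]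
  obtain ⟨C, hC⟩ := exists_rescaled_coshKernel_le h.tendsto
  have key : Tendsto (fun x : ℝ => ∫ η : ℝ, ((Real.exp (x / 2) / x ^ μ *
      coshKernel (fun ξ => Real.cosh ξ ^ 0) H x ((Real.sqrt x)⁻¹ * η) : ℝ) : ℂ) *
        Complex.exp (Complex.I * τ * ((Real.sqrt x)⁻¹ * η : ℝ))) atTop
      (𝓝 (∫ η : ℝ, ((Real.exp (-(1 / 4) * η ^ 2) : ℝ) : ℂ))) := by
    refine tendsto_integral_filter_of_dominated_convergence
      (fun η => C * Real.exp (-(1 / 8) * η ^ 2)) ?_ ?_ ?_ ?_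
    · filter_upwards [eventually_gt_atTop 0] with x hx
      have := continuous_coshKernel (isCoshBounded_cosh_pow 0) h.isAmplitude hx
      exact (by fun_prop : Continuous _).aestronglyMeasurable
    · filter_upwards [hC] with x hx
      refine Eventually.of_forall fun η => ?_
      rw [norm_ofReal_mul_cexp]
      exact hx η
    · exact (integrable_exp_neg_mul_sq (by norm_num)).const_mul C
    · refine Eventually.of_forall fun η => ?_
      have h3 : Tendsto (fun x : ℝ => (Real.sqrt x)⁻¹ * η) atTop (𝓝 0) := by
        simpa using (tendsto_inv_atTop_zero.comp Real.tendsto_sqrt_atTop).mul_const η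
      have h4 : Continuous fun t : ℝ => Complex.exp (Complex.I * τ * t) := by fun_prop
      have h5 := (h4.tendsto 0).comp h3
      have h6 := ((Complex.continuous_ofReal.tendsto _).comp
        (tendsto_rescaled_coshKernel h.tendsto η)).mul h5
      simpa using h6
  rw [hlim]
  refine key.congr' ?_
  filter_upwards [eventually_gt_atTop 0] with x hx
  have hs : 0 < Real.sqrt x := Real.sqrt_pos.2 hx
  rw [Measure.integral_comp_mul_left (fun ξ : ℝ => ((Real.exp (x / 2) / x ^ μ *
      coshKernel (fun ξ => Real.cosh ξ ^ 0) H x ξ : ℝ) : ℂ) *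
        Complex.exp (Complex.I * τ * ξ)) (Real.sqrt x)⁻¹, inv_inv, abs_of_pos hs, coshMoment,
    coshFourier, Complex.real_smul, Complex.ofReal_mul, mul_assoc,
    ← integral_const_mul ((Real.exp (x / 2) / x ^ μ : ℝ) : ℂ)]
  refine congrArg (fun z : ℂ => (Real.sqrt x : ℂ) * z)
    (integral_congr_ae (Eventually.of_forall fun ξ => ?_))
  simp only
  push_cast
  ring

theorem IsTricomi.isWhittakerW_coshMoment (h : IsTricomi μ H H') (τ : ℝ) :
    IsWhittakerW μ (Complex.I * τ)
      (fun x => ((1 / (2 * Real.sqrt Real.pi) : ℝ) : ℂ) * Real.sqrt x * coshMoment 0 H τ x) := by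
  refine ⟨h.whittaker_ode _ τ, (isEquivalent_iff_tendsto_one ?_).2 ?_⟩
  · filter_upwards [eventually_gt_atTop 0] with x hx
    exact Complex.ofReal_ne_zero.2 (by positivity)
  · have hπ : (Real.sqrt Real.pi : ℝ) ≠ 0 := (Real.sqrt_pos.2 Real.pi_pos).ne'
    have := (h.tendsto_coshMoment τ).const_mul ((1 / (2 * Real.sqrt Real.pi) : ℝ) : ℂ)
    rw [← Complex.ofReal_mul, one_div_mul_cancel (by positivity), Complex.ofReal_one] at this
    refine this.congr' ?_
    filter_upwards [eventually_gt_atTop 0] with x hx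
    have e : ((x ^ μ * Real.exp (-x / 2) : ℝ) : ℂ)⁻¹ = ((Real.exp (x / 2) / x ^ μ : ℝ) : ℂ) := by
      rw [← Complex.ofReal_inv, Complex.ofReal_inj, neg_div, Real.exp_neg]
      field_simp
    rw [Pi.div_apply, div_eq_mul_inv (_ * _ * _ : ℂ), e, Complex.ofReal_mul (Real.sqrt x)]
    ring

/-! ### The integral representation of W and its decay in τ. -/

theorem IsTricomi.whittakerW_eq_coshMoment (h : IsTricomi μ H H') (τ : ℝ) {x : ℝ} (hx : 0 < x) :
    whittakerW μ (Complex.I * τ) x =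
      ((1 / 2 * Real.sqrt (x / Real.pi) : ℝ) : ℂ) * coshMoment 0 H τ x := by
  rw [(h.isWhittakerW_coshMoment τ).whittakerW_eq hx, ← Complex.ofReal_mul]
  congr 2
  rw [Real.sqrt_div hx.le]
  field_simp

/-- After two integrations by parts, τ² times the moment is a combination of Fourier integrals, each
bounded by the L¹ norm of its kernel, which does not depend on τ. -/
theorem IsTricomi.exists_sq_mul_norm_coshMoment_le (h : IsTricomi μ H H') {x : ℝ} (hx : 0 < x) :
    ∃ C, ∀ τ : ℝ, τ ^ 2 * ‖coshMoment 0 H τ x‖ ≤ C := by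
  have hs : ∀ {G G' : ℝ → ℝ}, IsAmplitude G → IsAmplitude G' →
      (∀ y, 0 < y → HasDerivAt G (G' y) y) →
      ∃ C, ∀ τ : ℝ, ‖Complex.I * τ * coshFourier Real.sinh G τ x‖ ≤ C := by
    intro G G' hG hG' hd
    have hb := fun (n : ℕ) (G : ℝ → ℝ) (τ : ℝ) =>
      norm_coshFourier_le (fun ξ => Real.cosh ξ ^ n) G τ x
    let J := fun (n : ℕ) (G : ℝ → ℝ) => ∫ ξ, |coshKernel (fun ξ => Real.cosh ξ ^ n) G x ξ|
    refine ⟨J 1 G + ‖(x : ℂ) / 2‖ * (J 2 G' + J 0 G' + (J 2 G + J 0 G)), fun τ => ?_⟩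
    rw [I_mul_coshFourier_sinh hG hG' hd hx τ, norm_neg]
    refine (norm_add_le _ _).trans (add_le_add (hb 1 G τ) ?_)
    rw [norm_mul]
    refine mul_le_mul_of_nonneg_left ?_ (norm_nonneg _)
    exact (norm_sub_le _ _).trans (add_le_add ((norm_sub_le _ _).trans
      (add_le_add (hb 2 G' τ) (hb 0 G' τ))) ((norm_sub_le _ _).trans
      (add_le_add (hb 2 G τ) (hb 0 G τ))))
  obtain ⟨C0, hC0⟩ := hs h.isAmplitude h.isAmplitude' h.hasDerivAt
  obtain ⟨C1, hC1⟩ := hs h.isAmplitude' h.isAmplitude_second h.hasDerivAt'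
  refine ⟨‖(x : ℂ) / 2‖ * (C1 + C0), fun τ => ?_⟩
  have e : τ ^ 2 * ‖coshMoment 0 H τ x‖ =
      ‖Complex.I * τ * (Complex.I * τ * coshMoment 0 H τ x)‖ := by
    simp only [norm_mul, Complex.norm_I, Complex.norm_real, Real.norm_eq_abs]
    rw [← sq_abs]
    ring
  have e' : Complex.I * τ * (Complex.I * τ * coshMoment 0 H τ x) = -((x : ℂ) / 2 *
      (Complex.I * τ * coshFourier Real.sinh H' τ x -
        Complex.I * τ * coshFourier Real.sinh H τ x)) := by
    rw [I_mul_coshMoment_zero h.isAmplitude h.isAmplitude' h.hasDerivAt hx τ]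
    ring
  rw [e, e', norm_neg, norm_mul]
  exact mul_le_mul_of_nonneg_left
    ((norm_sub_le _ _).trans (add_le_add (hC1 τ) (hC0 τ))) (norm_nonneg _)

theorem IsTricomi.integrable_coshMoment (h : IsTricomi μ H H') {x : ℝ} (hx : 0 < x) :
    Integrable fun τ : ℝ => coshMoment 0 H τ x := by
  obtain ⟨C, hC⟩ := h.exists_sq_mul_norm_coshMoment_le hx
  refine Integrable.mono' (integrable_inv_one_add_sq.const_mul
    ((∫ ξ, |coshKernel (fun ξ => Real.cosh ξ ^ 0) H x ξ|) + C))
    (continuous_coshFourier (isCoshBounded_cosh_pow 0) h.isAmplitude hx).aestronglyMeasurable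
    (Eventually.of_forall fun τ => ?_)
  rw [← div_eq_mul_inv, le_div_iff₀ (by positivity)]
  have h1 : ‖coshMoment 0 H τ x‖ ≤ _ := norm_coshFourier_le (fun ξ => Real.cosh ξ ^ 0) H τ x
  linarith [hC τ]

end Tricomi

/-! ### Fourier inversion and the pair of transforms. -/

open scoped FourierTransform in
/-- Fourier inversion, with the normalisation `∫ g(ξ) e^{iτξ} dξ`. -/
theorem integral_fourier_mul_cexp {g : ℝ → ℂ} (hg : Continuous g) (hi : Integrable g)
    {F : ℝ → ℂ} (hF : ∀ τ : ℝ, F τ = ∫ ξ : ℝ, g ξ * Complex.exp (Complex.I * τ * ξ))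
    (hFi : Integrable F) (ξ : ℝ) :
    ∫ τ : ℝ, F τ * Complex.exp (-(Complex.I * τ * ξ)) = 2 * Real.pi * g ξ := by
  have hπ : -(2 * Real.pi) ≠ 0 := by simp [Real.pi_ne_zero]
  -- The transform `𝓕` uses the character e^{-2πivw}, so it is F rescaled by -2π; the Jacobian of
  -- this rescaling is the factor 2π in the result.
  have e : ∀ w : ℝ, 𝓕 g w = F (-(2 * Real.pi) * w) := by
    intro w
    rw [Real.fourier_eq', hF]
    congr 1
    ext v
    rw [smul_eq_mul, mul_comm]
    congr 2
    simp only [RCLike.inner_apply, conj_trivial]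
    push_cast
    ring
  have hFg : Integrable (𝓕 g) := by
    rw [show 𝓕 g = fun w => F (-(2 * Real.pi) * w) from funext e]
    exact hFi.comp_mul_left' hπ
  have h1 := hi.fourierInv_fourier_eq hFg (hg.continuousAt (x := ξ))
  rw [Real.fourierInv_eq'] at h1
  have h2 := Measure.integral_comp_mul_left
    (fun τ : ℝ => F τ * Complex.exp (-(Complex.I * τ * ξ))) (-(2 * Real.pi))
  have e2 : ∫ w : ℝ, F (-(2 * Real.pi) * w) *
      Complex.exp (-(Complex.I * ((-(2 * Real.pi) * w : ℝ) : ℂ) * ξ)) = g ξ := by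
    rw [← h1]
    congr 1
    ext w
    rw [e, smul_eq_mul, mul_comm]
    congr 2
    simp only [RCLike.inner_apply, conj_trivial]
    push_cast
    ring
  rw [e2, abs_inv, abs_neg, abs_of_pos (by positivity), Complex.real_smul] at h2
  have hπ' : (2 * Real.pi : ℂ) ≠ 0 := by simp [Real.pi_ne_zero]
  rw [h2, ← mul_assoc]
  push_cast
  rw [mul_inv_cancel₀ hπ', one_mul]

/-- Here z² = x(1 + cosh ξ), so the factor e^{-z²/4} inside D supplies e^{-x/4} and the second half
of the exponent (x/2) cosh ξ. -/
theorem IsTricomi.exp_mul_parabolicCylinderD {μ : ℝ} {H H' : ℝ → ℝ} (h : IsTricomi μ H H') {x : ℝ}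
    (hx : 0 < x) (ξ : ℝ) :
    (Real.exp (-(x / 4 * Real.cosh ξ)) : ℂ) *
      parabolicCylinderD (2 * μ) (Real.sqrt (2 * x) * Real.cosh (ξ / 2)) =
    ((2 ^ μ * Real.exp (-(x / 4)) : ℝ) : ℂ) * coshKernel (fun ξ => Real.cosh ξ ^ 0) H x ξ := by
  have hc := Real.cosh_pos (ξ / 2)
  have hz : (Real.sqrt (2 * x) * Real.cosh (ξ / 2)) ^ 2 = x * (1 + Real.cosh ξ) := by
    have := Real.cosh_two_mul (ξ / 2)
    rw [mul_div_cancel₀ ξ two_ne_zero, Real.sinh_sq] at this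
    rw [mul_pow, Real.sq_sqrt (by positivity), this]
    ring
  rw [h.parabolicCylinderD_eq (by positivity), hz, ← Complex.ofReal_mul, ← Complex.ofReal_mul,
    Complex.ofReal_inj, coshKernel, pow_zero, mul_one]
  have e1 : Real.exp (-(x / 4 * Real.cosh ξ)) * Real.exp (-(x * (1 + Real.cosh ξ)) / 4) =
      Real.exp (-(x / 4)) * Real.exp (-(x / 2 * Real.cosh ξ)) := by
    rw [← Real.exp_add, ← Real.exp_add]
    ring_nf
  have e2 : x * (1 + Real.cosh ξ) / 2 = x / 2 * (1 + Real.cosh ξ) := by ring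
  rw [e2]
  linear_combination (2 ^ μ * H (x / 2 * (1 + Real.cosh ξ))) * e1

theorem lemma1 (μ x : ℝ) (hx : 0 < x) :
    (∀ ξ : ℝ,
      Integrable (fun τ : ℝ =>
        whittakerW μ (Complex.I * τ) x * Complex.exp (-(Complex.I * τ * ξ))) ∧
      ∫ τ : ℝ, whittakerW μ (Complex.I * τ) x * Complex.exp (-(Complex.I * τ * ξ)) =
        ((2 ^ (-μ) * Real.sqrt (Real.pi * x) *
            Real.exp (x / 4 * (1 - Real.cosh ξ)) : ℝ) : ℂ) *
          parabolicCylinderD (2 * μ) (Real.sqrt (2 * x) * Real.cosh (ξ / 2))) ∧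
    (∀ τ : ℝ,
      Integrable (fun ξ : ℝ =>
        (Real.exp (-(x / 4 * Real.cosh ξ)) : ℂ) *
          parabolicCylinderD (2 * μ) (Real.sqrt (2 * x) * Real.cosh (ξ / 2)) *
          Complex.exp (Complex.I * τ * ξ)) ∧
      whittakerW μ (Complex.I * τ) x =
        ((Real.sqrt (x / Real.pi) * (Real.exp (x / 4) / 2 ^ (μ + 1)) : ℝ) : ℂ) *
          ∫ ξ : ℝ, (Real.exp (-(x / 4 * Real.cosh ξ)) : ℂ) *
            parabolicCylinderD (2 * μ) (Real.sqrt (2 * x) * Real.cosh (ξ / 2)) *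
            Complex.exp (Complex.I * τ * ξ)) := by
  obtain ⟨H, H', h⟩ := exists_isTricomi μ
  have hP := isCoshBounded_cosh_pow 0
  have hWi := (h.integrable_coshMoment hx).const_mul ((1 / 2 * Real.sqrt (x / Real.pi) : ℝ) : ℂ)
  simp only [← h.whittakerW_eq_coshMoment _ hx] at hWi
  refine ⟨fun ξ => ⟨?_, ?_⟩, fun τ => ⟨?_, ?_⟩⟩
  · refine hWi.norm.mono' (hWi.aestronglyMeasurable.mul
      (by fun_prop : Continuous fun τ : ℝ =>
        Complex.exp (-(Complex.I * τ * ξ))).aestronglyMeasurable)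
      (Eventually.of_forall fun τ => le_of_eq ?_)
    have := norm_cexp_I_mul (-τ) ξ
    rw [show Complex.I * ((-τ : ℝ) : ℂ) * ξ = -(Complex.I * τ * ξ) by push_cast; ring] at this
    rw [norm_mul, this, mul_one]
  · simp only [h.whittakerW_eq_coshMoment _ hx, mul_assoc]
    rw [integral_const_mul]
    have hk := continuous_coshKernel hP h.isAmplitude hx
    have h1 := integral_fourier_mul_cexp (Complex.continuous_ofReal.comp hk)
      (integrable_coshKernel hP h.isAmplitude hx).ofReal (F := fun τ => coshMoment 0 H τ x)
      (fun τ => rfl) (h.integrable_coshMoment hx) ξ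
    simp only [mul_assoc, Function.comp] at h1
    rw [h1]
    have h2 := h.exp_mul_parabolicCylinderD hx ξ
    have e1 : Real.exp (x / 4 * (1 - Real.cosh ξ)) =
        Real.exp (x / 4) * Real.exp (-(x / 4 * Real.cosh ξ)) := by
      rw [← Real.exp_add]
      ring_nf
    -- Inversion gives 2π, the representation of W gives ½ √(x/π), and their product is the √(πx) of
    -- the statement.
    have e2 : Real.sqrt (Real.pi * x) = Real.pi * Real.sqrt (x / Real.pi) := by
      rw [show Real.pi * x = Real.pi ^ 2 * (x / Real.pi) by field_simp,
        Real.sqrt_mul (by positivity), Real.sqrt_sq Real.pi_pos.le]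
    have e3 : 2 ^ (-μ) * Real.sqrt (Real.pi * x) * Real.exp (x / 4) *
        (2 ^ μ * Real.exp (-(x / 4))) = Real.pi * Real.sqrt (x / Real.pi) := by
      rw [e2, Real.rpow_neg two_pos.le, Real.exp_neg]
      field_simp
    have e4 := congrArg (fun r : ℝ => (r : ℂ)) e3
    have e5 : ((1 / 2 : ℝ) : ℂ) = 1 / 2 := by norm_num
    simp only [e1, Complex.ofReal_mul] at h2 e4 ⊢
    rw [e5]
    linear_combination (-coshKernel (fun ξ => Real.cosh ξ ^ 0) H x ξ : ℂ) * e4 -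
      (((2 ^ (-μ) : ℝ) : ℂ) * Real.sqrt (Real.pi * x) * Real.exp (x / 4)) * h2
  · simp only [h.exp_mul_parabolicCylinderD hx,
      mul_assoc ((2 ^ μ * Real.exp (-(x / 4)) : ℝ) : ℂ)]
    exact (integrable_coshKernel_mul_cexp hP h.isAmplitude hx τ).const_mul _
  · simp only [h.exp_mul_parabolicCylinderD hx,
      mul_assoc ((2 ^ μ * Real.exp (-(x / 4)) : ℝ) : ℂ)]
    rw [integral_const_mul, h.whittakerW_eq_coshMoment _ hx, ← mul_assoc, ← Complex.ofReal_mul]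
    have e : Real.sqrt (x / Real.pi) * (Real.exp (x / 4) / 2 ^ (μ + 1)) *
        (2 ^ μ * Real.exp (-(x / 4))) = 1 / 2 * Real.sqrt (x / Real.pi) := by
      rw [Real.rpow_add_one two_ne_zero, Real.exp_neg]
      field_simp
    rw [mul_assoc (Real.sqrt _)] at e
    rw [mul_assoc, e]
    rfl
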